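/- **Setting.** All matrix sizes are positive integers. Let $V$ be a complex $*$-vector space (complex vector space with a conjugate-linear involution); $M_{m,n}(V)$ denotes the $m\times n$ matrices over $V$, $M_n(V)=M_{n,n}(V)$, $M_{m,n}=M_{m,n}(\mathbb C)$ with the operator norm, $v^*=[v_{j,i}^*]$, $v\oplus w=\begin{bmatrix}v&0\\0&w\end{bmatrix}$, $M_n(V)_{sa}=\{v\in M_n(V):v=v^*\}$ and $e^n=e\oplus\cdots\oplus e\in M_n(V)$. $(V,e)$ is an *absolute matrix order unit space* if it is given together with convex cones $M_n(V)^+\subseteq M_n(V)_{sa}$ (containing $0$), an element $e\in V^+=M_1(V)^+$ and maps $|\cdot|_{m,n}:M_{m,n}(V)\to M_n(V)^+$ (with $|\cdot|_n=|\cdot|_{n,n}$) such that, writing $v\le w$ for $w-v\in M_n(V)^+$: - $a^*va\in M_m(V)^+$ for $v\in M_n(V)^+$, $a\in M_{n,m}$; $V^+\cap(-V^+)=\{0\}$; for each $v\in V_{sa}$ there is $k>0$ with $ke\pm v\in V^+$; and if $u\in M_n(V)^+$, $v\in M_n(V)_{sa}$ and $ku+v\in M_n(V)^+$ for all real $k>0$,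 then $v\in M_n(V)^+$; - for every $n$ and all $u,v,w\in M_n(V)_{sa}$, $k\in\mathbb R$: $|v|_n=v$ if $v\ge0$; $|v|_n\pm v\ge 0$; $|kv|_n=|k|\,|v|_n$; if $|u-v|_n=u+v$ and $0\le w\le v$, then $|u-w|_n=u+w$; if $|u-v|_n=u+v$ and $|u-w|_n=u+w$, then $\bigl|u-|v\pm w|_n\bigr|_n=u+|v\pm w|_n$; - $|\alpha v\beta|_{r,s}\le\|\alpha\|\,\bigl||v|_{m,n}\beta\bigr|_{n,s}$ for $v\in M_{m,n}(V)$, $\alpha\in M_{r,m}$, $\beta\in M_{n,s}$; and $|v\oplus w|_{m+r,n+s}=|v|_{m,n}\oplus|w|_{r,s}$ for $v\in M_{m,n}(V)$, $w\in M_{r,s}(V)$; - with $\|v\|_n=\inf\{k>0:\begin{bmatrix}ke^n&v\\v^*&ke^n\end{bmatrix}\in M_{2n}(V)^+\}$, for all $u,v\in M_n(V)^+$: $|u-v|_n=u+v$ if and only if $\|u_1+kv_1\|_n=\max\{\|u_1\|_n,\|kv_1\|_n\}$ for all $0\le u_1\le u$, $0\le v_1\le v$ and $k\in\mathbb R$.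 Continuity in $M_n(V)$ refers to $\|\cdot\|_n$. Put $\mathcal{OP}_n(V)=\{p\in M_n(V):p^*=p,\ |2p-e^n|_n=e^n\}$ (order projections), $\mathcal{PI}_{m,n}(V)=\{v\in M_{m,n}(V):|v|_{m,n}\in\mathcal{OP}_n(V),\ |v^*|_{n,m}\in\mathcal{OP}_m(V)\}$ (partial isometries), $\mathcal U_n(V)=\{u\in M_n(V):|u|_n=e^n=|u^*|_n\}$ (unitaries), $\mathcal{PU}_n(V)=\{u\in M_n(V):|u|_n=|u^*|_n\in\mathcal{OP}_n(V)\}$ (partial unitaries), and let $\mathcal{OP}_\infty,\mathcal U_\infty,\mathcal{PU}_\infty$ be the unions over $n\ge1$, each element being taken with its size. In each of $\mathcal{OP}_n,\mathcal U_n,\mathcal{PU}_n$, $x\sim_h y$ means that $x$ and $y$ are joined by a continuous path $[0,1]\to M_n(V)$ inside that set. For $p\in\mathcal{OP}_m(V)$, $q\in\mathcal{OP}_n(V)$, $p\sim q$ means that $p=|v^*|_{n,m}$ and $q=|v|_{m,n}$ for some $v\in\mathcal{PI}_{m,n}(V)$. For $u,v$ in $\mathcal U_\infty$ (resp. $\mathcal{PU}_\infty$)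 of sizes $m,n$, $u\sim_1v$ (resp. $u\sim_Kv$) means that for some $k>\max\{m,n\}$ one has $u\oplus e^{k-m}\sim_hv\oplus e^{k-n}$ in $\mathcal U_k(V)$ (resp. $u\oplus0_{k-m}\sim_hv\oplus0_{k-n}$ in $\mathcal{PU}_k(V)$). For $(X,\sim_X)$ equal to $(\mathcal{OP}_\infty,\sim)$, $(\mathcal U_\infty,\sim_1)$, $(\mathcal{PU}_\infty,\sim_K)$, write $x\approx_X y$ if $x\oplus z\sim_X y\oplus z$ for some $z\in X$, and $(x_1,y_1)\equiv_X(x_2,y_2)$ if $x_1\oplus y_2\approx_X x_2\oplus y_1$. Then $K_0(V)$, $K_1(V)$, $K(V)$ respectively denote the sets of classes $[(x,y)]$ of $X\times X$ under $\equiv_X$, with $[(x_1,y_1)]+[(x_2,y_2)]=[(x_1\oplus x_2,y_1\oplus y_2)]$. **Theorem.** Let $(V,e)$ be an absolute matrix order unit space such that - (T) whenever $u\in\mathcal{PI}_{m,n}(V)$, $v\in\mathcal{PI}_{l,n}(V)$ and $|u|_{m,n}=|v|_{l,n}$, there is $w\in\mathcal{PI}_{m,l}(V)$ with $|w^*|_{l,m}=|u^*|_{n,m}$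 and $|w|_{m,l}=|v^*|_{n,l}$; - $|\cdot|_n:M_n(V)\to M_n(V)$ is continuous for every $n$; - for every $n$ and $p,q\in\mathcal{OP}_n(V)$, $p\sim_hq$ in $\mathcal{OP}_n(V)$ implies $p\sim q$. Then the three relations $\equiv_X$ are equivalence relations, the additions on $K_0(V)$, $K_1(V)$, $K(V)$ are well defined and make them abelian groups, and there is a surjective group homomorphism $\theta:K(V)\to K_0(V)\oplus K_1(V)$ such that for every $n$ and $u\in\mathcal{PU}_n(V)$ one has $u+e^n-|u|_n\in\mathcal U_n(V)$ and $$\theta([(u,0)])=\bigl([(|u|_n,0)],\,[(u+e^n-|u|_n,\,e)]\bigr).$$ Moreover $K(V)/\ker\theta\cong K_0(V)\oplus K_1(V)$. -/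

import Mathlib

/-!
Absolute matrix order unit spaces and their groups `K₀`, `K₁` and `K`.

`V` is a `*`-vector space: a complex vector space with a conjugate-linear involution.
All matrix sizes that occur are positive: the conditions below are imposed for sizes `≥ 1` only
(the values of `pos n`, `abs m n` at size `0` are never used).
-/

namespace AMOU

variable {V : Type*} [AddCommGroup V] [Module ℂ V]

/-- `α v` for a scalar matrix `α` and a matrix `v` over `V`. -/
def lmul {r m n : ℕ} (α : Matrix (Fin r) (Fin m) ℂ) (v : Matrix (Fin m) (Fin n) V) :
    Matrix (Fin r) (Fin n) V :=
  Matrix.of fun i j => ∑ k, α i k • v k j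

/-- `v β` for a matrix `v` over `V` and a scalar matrix `β`. -/
def rmul {m n s : ℕ} (v : Matrix (Fin m) (Fin n) V) (β : Matrix (Fin n) (Fin s) ℂ) :
    Matrix (Fin m) (Fin s) V :=
  Matrix.of fun i j => ∑ k, β k j • v i k

/-- The block matrix `[a, b; c, d]`. -/
def block {m r n s : ℕ} (a : Matrix (Fin m) (Fin n) V) (b : Matrix (Fin m) (Fin s) V)
    (c : Matrix (Fin r) (Fin n) V) (d : Matrix (Fin r) (Fin s) V) :
    Matrix (Fin (m + r)) (Fin (n + s)) V :=
  Matrix.reindex finSumFinEquiv finSumFinEquiv (Matrix.fromBlocks a b c d)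

/-- `v ⊕ w`. -/
def oplus {m n r s : ℕ} (v : Matrix (Fin m) (Fin n) V) (w : Matrix (Fin r) (Fin s) V) :
    Matrix (Fin (m + r)) (Fin (n + s)) V :=
  block v 0 0 w

/-- `eⁿ = e ⊕ ⋯ ⊕ e`. -/
def unitMat (e : V) (n : ℕ) : Matrix (Fin n) (Fin n) V := Matrix.diagonal fun _ => e

/-- A square matrix of size `m`, regarded as one of size `k = m`. -/
def castSq {m k : ℕ} (h : m = k) (v : Matrix (Fin m) (Fin m) V) : Matrix (Fin k) (Fin k) V :=
  Matrix.reindex (finCongr h) (finCongr h) v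

theorem oplus_unitMat (e : V) (m n : ℕ) :
    oplus (unitMat e m) (unitMat e n) = unitMat e (m + n) := by
  ext i j
  refine Fin.addCases (fun a => ?_) (fun a => ?_) i <;>
    refine Fin.addCases (fun b => ?_) (fun b => ?_) j <;>
    simp [oplus, block, unitMat, Matrix.diagonal_apply, Fin.ext_iff] <;> omega

theorem smul_oplus {m n r s : ℕ} (k : ℂ) (v : Matrix (Fin m) (Fin n) V)
    (w : Matrix (Fin r) (Fin s) V) : k • oplus v w = oplus (k • v) (k • w) := by
  ext i j
  refine Fin.addCases (fun a => ?_) (fun a => ?_) i <;>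
    refine Fin.addCases (fun b => ?_) (fun b => ?_) j <;> simp [oplus, block]

theorem oplus_sub_oplus {m n r s : ℕ} (v v' : Matrix (Fin m) (Fin n) V)
    (w w' : Matrix (Fin r) (Fin s) V) : oplus v w - oplus v' w' = oplus (v - v') (w - w') := by
  ext i j
  refine Fin.addCases (fun a => ?_) (fun a => ?_) i <;>
    refine Fin.addCases (fun b => ?_) (fun b => ?_) j <;> simp [oplus, block]

section opNorm
open scoped Matrix.Norms.L2Operator

/-- The operator norm of a scalar matrix between Euclidean (Hilbert) spaces. -/
noncomputable def opNorm {r m : ℕ} (α : Matrix (Fin r) (Fin m) ℂ) : ℝ := ‖α‖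

end opNorm

variable [StarAddMonoid V]

theorem conjTranspose_oplus {m n r s : ℕ} (v : Matrix (Fin m) (Fin n) V)
    (w : Matrix (Fin r) (Fin s) V) :
    (oplus v w).conjTranspose = oplus v.conjTranspose w.conjTranspose := by
  ext i j
  refine Fin.addCases (fun a => ?_) (fun a => ?_) i <;>
    refine Fin.addCases (fun b => ?_) (fun b => ?_) j <;> simp [oplus, block]

variable (V) in
/-- A matrix ordered space: cones `M_n(V)⁺ ⊆ M_n(V)_sa`, compatible with scalar compressions. -/
structure MatrixOrderedSpace where
  /-- The cone `M_n(V)⁺`. -/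
  pos : ∀ n : ℕ, Set (Matrix (Fin n) (Fin n) V)
  isHermitian_of_mem : ∀ n, 0 < n → ∀ v ∈ pos n, v.IsHermitian
  zero_mem : ∀ n, 0 < n → 0 ∈ pos n
  add_mem : ∀ n, 0 < n → ∀ v ∈ pos n, ∀ w ∈ pos n, v + w ∈ pos n
  smul_mem : ∀ n, 0 < n → ∀ k : ℝ, 0 ≤ k → ∀ v ∈ pos n, (k : ℂ) • v ∈ pos n
  conj_mem : ∀ n m, 0 < n → 0 < m → ∀ v ∈ pos n, ∀ a : Matrix (Fin n) (Fin m) ℂ,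
    lmul a.conjTranspose (rmul v a) ∈ pos m

variable (V) in
/-- A matrix order unit space; `V` is identified with `M_1(V)`. -/
structure MatrixOrderUnitSpace extends MatrixOrderedSpace V where
  /-- The order unit. -/
  e : V
  unit_mem : unitMat e 1 ∈ pos 1
  orderUnit : ∀ v : Matrix (Fin 1) (Fin 1) V, v.IsHermitian →
    ∃ k : ℝ, 0 < k ∧ (k : ℂ) • unitMat e 1 + v ∈ pos 1 ∧ (k : ℂ) • unitMat e 1 - v ∈ pos 1
  proper : ∀ v ∈ pos 1, -v ∈ pos 1 → v = 0
  archimedean : ∀ n, 0 < n → ∀ u ∈ pos n, ∀ v : Matrix (Fin n) (Fin n) V, v.IsHermitian →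
    (∀ k : ℝ, 0 < k → (k : ℂ) • u + v ∈ pos n) → v ∈ pos n

namespace MatrixOrderUnitSpace

variable (S : MatrixOrderUnitSpace V) {n : ℕ}

/-- The matrix norm `‖v‖_n = inf {k > 0 : [k eⁿ, v; v*, k eⁿ] ∈ M_{2n}(V)⁺}`. -/
noncomputable def mnorm (v : Matrix (Fin n) (Fin n) V) : ℝ :=
  sInf {k : ℝ | 0 < k ∧
    block ((k : ℂ) • unitMat S.e n) v v.conjTranspose ((k : ℂ) • unitMat S.e n) ∈ S.pos (n + n)}

/-- `u ⊥_∞ v`. -/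
def PerpInf (u v : Matrix (Fin n) (Fin n) V) : Prop :=
  ∀ k : ℝ, S.mnorm (u + (k : ℂ) • v) = max (S.mnorm u) (S.mnorm ((k : ℂ) • v))

/-- `u ⊥_∞^a v`: all `0 ≤ u₁ ≤ u` and `0 ≤ v₁ ≤ v` satisfy `u₁ ⊥_∞ v₁`. -/
def PerpInfA (u v : Matrix (Fin n) (Fin n) V) : Prop :=
  ∀ u₁ v₁ : Matrix (Fin n) (Fin n) V, u₁ ∈ S.pos n → u - u₁ ∈ S.pos n →
    v₁ ∈ S.pos n → v - v₁ ∈ S.pos n → S.PerpInf u₁ v₁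

/-- `u ∼_h v` in the set `A ⊆ M_n(V)`: there is a norm continuous path in `A` from `u` to `v`. -/
def Homotopic (A : Set (Matrix (Fin n) (Fin n) V)) (u v : Matrix (Fin n) (Fin n) V) : Prop :=
  ∃ f : unitInterval → Matrix (Fin n) (Fin n) V,
    (∀ t, f t ∈ A) ∧
    (∀ t, ∀ ε : ℝ, 0 < ε → ∃ δ : ℝ, 0 < δ ∧ ∀ s, dist s t < δ → S.mnorm (f s - f t) < ε) ∧
    f 0 = u ∧ f 1 = v

end MatrixOrderUnitSpace

/-- `(E_sa, C, |·|)` is an absolutely ordered space; `E_sa` is a real subspace of the complex vector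
space `E`, `C ⊆ E_sa` a cone, and the absolute value is the restriction of `a` to `E_sa`. -/
structure IsAbsolutelyOrdered {E : Type*} [AddCommGroup E] [Module ℂ E] (Esa C : Set E)
    (a : E → E) : Prop where
  abs_mem : ∀ v ∈ Esa, a v ∈ C
  abs_of_mem : ∀ v ∈ C, a v = v
  abs_add_mem : ∀ v ∈ Esa, a v + v ∈ C
  abs_sub_mem : ∀ v ∈ Esa, a v - v ∈ C
  abs_smul : ∀ v ∈ Esa, ∀ k : ℝ, a ((k : ℂ) • v) = ((|k| : ℝ) : ℂ) • a v
  perp_of_le : ∀ u ∈ Esa, ∀ v ∈ Esa, ∀ w ∈ Esa, a (u - v) = u + v → w ∈ C → v - w ∈ C →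
    a (u - w) = u + w
  perp_abs_add : ∀ u ∈ Esa, ∀ v ∈ Esa, ∀ w ∈ Esa, a (u - v) = u + v → a (u - w) = u + w →
    a (u - a (v + w)) = u + a (v + w)
  perp_abs_sub : ∀ u ∈ Esa, ∀ v ∈ Esa, ∀ w ∈ Esa, a (u - v) = u + v → a (u - w) = u + w →
    a (u - a (v - w)) = u + a (v - w)

variable (V) in
/-- An absolute matrix order unit space. -/
structure AbsMatrixOrderUnitSpace extends MatrixOrderUnitSpace V where
  /-- The absolute value `|·|_{m,n} : M_{m,n}(V) → M_n(V)⁺`. -/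
  abs : ∀ m n : ℕ, Matrix (Fin m) (Fin n) V → Matrix (Fin n) (Fin n) V
  abs_mem : ∀ m n, 0 < m → 0 < n → ∀ v, abs m n v ∈ pos n
  isAbsolutelyOrdered : ∀ n, 0 < n →
    IsAbsolutelyOrdered {v : Matrix (Fin n) (Fin n) V | v.IsHermitian} (pos n) (abs n n)
  abs_mul_le : ∀ r m n s, 0 < r → 0 < m → 0 < n → 0 < s →
    ∀ (α : Matrix (Fin r) (Fin m) ℂ) (v : Matrix (Fin m) (Fin n) V) (β : Matrix (Fin n) (Fin s) ℂ),
      (opNorm α : ℂ) • abs n s (rmul (abs m n v) β) - abs r s (lmul α (rmul v β)) ∈ pos s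
  abs_oplus : ∀ m n r s, 0 < m → 0 < n → 0 < r → 0 < s →
    ∀ (v : Matrix (Fin m) (Fin n) V) (w : Matrix (Fin r) (Fin s) V),
      abs (m + r) (n + s) (oplus v w) = oplus (abs m n v) (abs r s w)
  /-- `⊥ = ⊥_∞^a` on `M_n(V)⁺`, where `u ⊥ v` means `|u - v|_n = u + v`. -/
  perp_iff : ∀ n, 0 < n → ∀ u ∈ pos n, ∀ v ∈ pos n,
    (abs n n (u - v) = u + v ↔ toMatrixOrderUnitSpace.PerpInfA u v)

namespace AbsMatrixOrderUnitSpace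

variable (S : AbsMatrixOrderUnitSpace V)

/-- `OP_n(V)`: order projections. -/
def OP (n : ℕ) : Set (Matrix (Fin n) (Fin n) V) :=
  {p | p.conjTranspose = p ∧ S.abs n n ((2 : ℂ) • p - unitMat S.e n) = unitMat S.e n}

/-- `PI_{m,n}(V)`: partial isometries. -/
def PI (m n : ℕ) : Set (Matrix (Fin m) (Fin n) V) :=
  {v | S.abs m n v ∈ S.OP n ∧ S.abs n m v.conjTranspose ∈ S.OP m}

/-- `U_n(V)`: unitaries. -/
def U (n : ℕ) : Set (Matrix (Fin n) (Fin n) V) :=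
  {u | S.abs n n u = unitMat S.e n ∧ S.abs n n u.conjTranspose = unitMat S.e n}

/-- `PU_n(V)`: partial unitaries. -/
def PU (n : ℕ) : Set (Matrix (Fin n) (Fin n) V) :=
  {u | S.abs n n u = S.abs n n u.conjTranspose ∧ S.abs n n u ∈ S.OP n}

/-- Condition (T). -/
def CondT : Prop :=
  ∀ m n l : ℕ, 0 < m → 0 < n → 0 < l → ∀ u ∈ S.PI m n, ∀ v ∈ S.PI l n,
    S.abs m n u = S.abs l n v →
    ∃ w ∈ S.PI m l, S.abs l m w.conjTranspose = S.abs n m u.conjTranspose ∧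
      S.abs m l w = S.abs n l v.conjTranspose

/-- `|·|_n : M_n(V) → M_n(V)⁺` is norm continuous. -/
def AbsContinuous (n : ℕ) : Prop :=
  ∀ v : Matrix (Fin n) (Fin n) V, ∀ ε : ℝ, 0 < ε → ∃ δ : ℝ, 0 < δ ∧
    ∀ w : Matrix (Fin n) (Fin n) V, S.mnorm (w - v) < δ → S.mnorm (S.abs n n w - S.abs n n v) < ε

/-- `p ∼ q` for `p ∈ M_m(V)`, `q ∈ M_n(V)`: partial isometric equivalence. -/
def PIEquiv {m n : ℕ} (p : Matrix (Fin m) (Fin m) V) (q : Matrix (Fin n) (Fin n) V) : Prop :=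
  ∃ v ∈ S.PI m n, p = S.abs n m v.conjTranspose ∧ q = S.abs m n v

/-! Helper facts, needed for `⊕` and for the base points `0`, `e`. -/

theorem unit_mem_pos {n : ℕ} (hn : 0 < n) : unitMat S.e n ∈ S.pos n := by
  have h : ∀ m : ℕ, unitMat S.e (m + 1) ∈ S.pos (m + 1) := by
    intro m
    induction m with
    | zero => exact S.unit_mem
    | succ k ih =>
      have h1 := S.abs_oplus (k + 1) (k + 1) 1 1 k.succ_pos k.succ_pos one_pos one_pos
        (unitMat S.e (k + 1)) (unitMat S.e 1)
      rw [(S.isAbsolutelyOrdered _ k.succ_pos).abs_of_mem _ ih,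
        (S.isAbsolutelyOrdered _ one_pos).abs_of_mem _ S.unit_mem, oplus_unitMat] at h1
      rw [← h1]
      exact S.abs_mem _ _ (Nat.succ_pos _) (Nat.succ_pos _) _
  obtain ⟨m, rfl⟩ : ∃ m, n = m + 1 := ⟨n - 1, by omega⟩
  exact h m

theorem unit_mem_U {n : ℕ} (hn : 0 < n) : unitMat S.e n ∈ S.U n := by
  have h := unit_mem_pos S hn
  have h2 := (S.isAbsolutelyOrdered n hn).abs_of_mem _ h
  exact ⟨h2, by rw [S.isHermitian_of_mem n hn _ h, h2]⟩

theorem zero_mem_OP {n : ℕ} (hn : 0 < n) : (0 : Matrix (Fin n) (Fin n) V) ∈ S.OP n := by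
  have h := unit_mem_pos S hn
  have h2 := (S.isAbsolutelyOrdered n hn).abs_smul _ (S.isHermitian_of_mem n hn _ h) (-1)
  rw [(S.isAbsolutelyOrdered n hn).abs_of_mem _ h] at h2
  refine ⟨Matrix.conjTranspose_zero, ?_⟩
  simpa using h2

theorem zero_mem_PU {n : ℕ} (hn : 0 < n) : (0 : Matrix (Fin n) (Fin n) V) ∈ S.PU n := by
  have h := (S.isAbsolutelyOrdered n hn).abs_of_mem _ (S.zero_mem n hn)
  refine ⟨by rw [Matrix.conjTranspose_zero], ?_⟩
  rw [h]
  exact zero_mem_OP S hn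

theorem oplus_mem_OP {m n : ℕ} (hm : 0 < m) (hn : 0 < n) {p : Matrix (Fin m) (Fin m) V}
    {q : Matrix (Fin n) (Fin n) V} (hp : p ∈ S.OP m) (hq : q ∈ S.OP n) :
    oplus p q ∈ S.OP (m + n) := by
  refine ⟨by rw [conjTranspose_oplus, hp.1, hq.1], ?_⟩
  rw [← oplus_unitMat, smul_oplus, oplus_sub_oplus, S.abs_oplus m m n n hm hm hn hn, hp.2, hq.2]

theorem oplus_mem_U {m n : ℕ} (hm : 0 < m) (hn : 0 < n) {u : Matrix (Fin m) (Fin m) V}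
    {v : Matrix (Fin n) (Fin n) V} (hu : u ∈ S.U m) (hv : v ∈ S.U n) :
    oplus u v ∈ S.U (m + n) := by
  constructor
  · rw [S.abs_oplus m m n n hm hm hn hn, hu.1, hv.1, oplus_unitMat]
  · rw [conjTranspose_oplus, S.abs_oplus m m n n hm hm hn hn, hu.2, hv.2, oplus_unitMat]

theorem oplus_mem_PU {m n : ℕ} (hm : 0 < m) (hn : 0 < n) {u : Matrix (Fin m) (Fin m) V}
    {v : Matrix (Fin n) (Fin n) V} (hu : u ∈ S.PU m) (hv : v ∈ S.PU n) :
    oplus u v ∈ S.PU (m + n) := by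
  constructor
  · rw [conjTranspose_oplus, S.abs_oplus m m n n hm hm hn hn, S.abs_oplus m m n n hm hm hn hn,
      hu.1, hv.1]
  · rw [S.abs_oplus m m n n hm hm hn hn]
    exact oplus_mem_OP S hm hn hu.2 hv.2

/-- `OP_∞(V) = ⋃ₙ OP_n(V)`, an element being recorded together with its size. -/
structure OPInf where
  n : ℕ
  hn : 0 < n
  val : Matrix (Fin n) (Fin n) V
  mem : val ∈ S.OP n

/-- `U_∞(V) = ⋃ₙ U_n(V)`, an element being recorded together with its size. -/
structure UInf where
  n : ℕ
  hn : 0 < n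
  val : Matrix (Fin n) (Fin n) V
  mem : val ∈ S.U n

/-- `PU_∞(V) = ⋃ₙ PU_n(V)`, an element being recorded together with its size. -/
structure PUInf where
  n : ℕ
  hn : 0 < n
  val : Matrix (Fin n) (Fin n) V
  mem : val ∈ S.PU n

variable {S}

/-! ### `K₀` -/

namespace OPInf

/-- `p ⊕ q`. -/
def sum (p q : S.OPInf) : S.OPInf :=
  ⟨p.n + q.n, Nat.add_pos_left p.hn _, oplus p.val q.val, oplus_mem_OP S p.hn q.hn p.mem q.mem⟩

variable (S) in
/-- `0 ∈ OP_1(V)`. -/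
def zero : S.OPInf := ⟨1, one_pos, 0, zero_mem_OP S one_pos⟩

/-- `p ∼ q`. -/
def Sim (p q : S.OPInf) : Prop := S.PIEquiv p.val q.val

/-- `p ≈ q`. -/
def Approx (p q : S.OPInf) : Prop := ∃ r : S.OPInf, (p.sum r).Sim (q.sum r)

end OPInf

variable (S) in
/-- `(p₁, q₁) ≡ (p₂, q₂)` iff `p₁ ⊕ q₂ ≈ p₂ ⊕ q₁`. -/
def K0Rel (x y : S.OPInf × S.OPInf) : Prop := (x.1.sum y.2).Approx (y.1.sum x.2)

variable (S) in
/-- The set `K₀(V)` of classes `[(p, q)]`. -/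
def K0 : Type _ := Quot S.K0Rel

/-- The class `[(p, q)] ∈ K₀(V)`. -/
def K0.mk (p q : S.OPInf) : S.K0 := Quot.mk _ (p, q)

/-! ### `K₁` -/

namespace UInf

/-- `u ⊕ v`. -/
def sum (u v : S.UInf) : S.UInf :=
  ⟨u.n + v.n, Nat.add_pos_left u.hn _, oplus u.val v.val, oplus_mem_U S u.hn v.hn u.mem v.mem⟩

variable (S) in
/-- `e ∈ U_1(V)`. -/
def unit : S.UInf := ⟨1, one_pos, unitMat S.e 1, unit_mem_U S one_pos⟩

/-- `u ∼₁ v`: `u ⊕ e^{k-m} ∼_h v ⊕ e^{k-n}` in `U_k(V)` for some `k > max {m, n}`. -/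
def Sim (u v : S.UInf) : Prop :=
  ∃ (k a b : ℕ) (ha : u.n + a = k) (hb : v.n + b = k), max u.n v.n < k ∧
    S.Homotopic (S.U k) (castSq ha (oplus u.val (unitMat S.e a)))
      (castSq hb (oplus v.val (unitMat S.e b)))

/-- `u ≈₁ v`. -/
def Approx (u v : S.UInf) : Prop := ∃ w : S.UInf, (u.sum w).Sim (v.sum w)

end UInf

variable (S) in
/-- `(u₁, v₁) ≡₁ (u₂, v₂)` iff `u₁ ⊕ v₂ ≈₁ u₂ ⊕ v₁`. -/
def K1Rel (x y : S.UInf × S.UInf) : Prop := (x.1.sum y.2).Approx (y.1.sum x.2)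

variable (S) in
/-- The set `K₁(V)` of classes `[(u, v)]`. -/
def K1 : Type _ := Quot S.K1Rel

/-- The class `[(u, v)] ∈ K₁(V)`. -/
def K1.mk (u v : S.UInf) : S.K1 := Quot.mk _ (u, v)

/-! ### `K` -/

namespace PUInf

/-- `u ⊕ v`. -/
def sum (u v : S.PUInf) : S.PUInf :=
  ⟨u.n + v.n, Nat.add_pos_left u.hn _, oplus u.val v.val, oplus_mem_PU S u.hn v.hn u.mem v.mem⟩

variable (S) in
/-- `0 ∈ PU_1(V)`. -/
def zero : S.PUInf := ⟨1, one_pos, 0, zero_mem_PU S one_pos⟩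

/-- `u ∼_K v`: `u ⊕ 0_{k-m} ∼_h v ⊕ 0_{k-n}` in `PU_k(V)` for some `k > max {m, n}`. -/
def Sim (u v : S.PUInf) : Prop :=
  ∃ (k a b : ℕ) (ha : u.n + a = k) (hb : v.n + b = k), max u.n v.n < k ∧
    S.Homotopic (S.PU k)
      (castSq ha (oplus u.val (0 : Matrix (Fin a) (Fin a) V)))
      (castSq hb (oplus v.val (0 : Matrix (Fin b) (Fin b) V)))

/-- `u ≈_K v`. -/
def Approx (u v : S.PUInf) : Prop := ∃ w : S.PUInf, (u.sum w).Sim (v.sum w)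

/-- The order projection `|u|` of a partial unitary `u`. -/
def absProj (u : S.PUInf) : S.OPInf := ⟨u.n, u.hn, S.abs u.n u.n u.val, u.mem.2⟩

end PUInf

variable (S) in
/-- `(u₁, v₁) ≡_K (u₂, v₂)` iff `u₁ ⊕ v₂ ≈_K u₂ ⊕ v₁`. -/
def KRel (x y : S.PUInf × S.PUInf) : Prop := (x.1.sum y.2).Approx (y.1.sum x.2)

variable (S) in
/-- The set `K(V)` of classes `[(u, v)]`. -/
def K : Type _ := Quot S.KRel

/-- The class `[(u, v)] ∈ K(V)`. -/
def K.mk (u v : S.PUInf) : S.K := Quot.mk _ (u, v)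

end AbsMatrixOrderUnitSpace

end AMOU

/-!
Orthogonality `|u - v| = u + v` of positive matrices is additive in each argument, so
`|x + y| = |x| + |y|` for selfadjoint `x`, `y` with orthogonal absolute values. For a partial
unitary `u`, applying this to the selfadjoint dilations `[[0, u], [u*, 0]]` and
`[[0, e - |u|], [e - |u|, 0]]` shows that `u + e - |u|` is unitary.

The absolute value is invariant under scalar unitaries, and the unitary group of `M_n` is
path-connected, so permuting the blocks of `u₁ ⊕ ⋯ ⊕ uₖ` changes it only up to homotopy within
`U_n(V)` or `PU_n(V)`. Hence `OP_∞/∼`, `U_∞/∼₁` and `PU_∞/∼_K` are commutative monoids, with group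
completions `K₀(V)`, `K₁(V)` and `K(V)`. By continuity of `|·|`, the maps `u ↦ |u|` and
`u ↦ u + e - |u|` preserve homotopy, and they are additive; they induce the two components of `θ`.
For an order projection `p` the second map gives `p ↦ eⁿ ∼₁ e`, while on unitaries it is the
identity, so `θ` is onto.
-/

namespace AMOU

open Matrix

section Scalar

variable {V : Type*} [AddCommGroup V] [Module ℂ V] {l m n r s : ℕ}

theorem lmul_one (v : Matrix (Fin m) (Fin n) V) : lmul 1 v = v := by
  ext i j
  simp [lmul, Matrix.one_apply]

theorem rmul_one (v : Matrix (Fin m) (Fin n) V) : rmul v 1 = v := by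
  ext i j
  simp [rmul, Matrix.one_apply]

theorem lmul_lmul (α : Matrix (Fin l) (Fin r) ℂ) (β : Matrix (Fin r) (Fin m) ℂ)
    (v : Matrix (Fin m) (Fin n) V) : lmul α (lmul β v) = lmul (α * β) v := by
  ext i j
  simp only [lmul, of_apply, Matrix.mul_apply, Finset.smul_sum, Finset.sum_smul, mul_smul]
  exact Finset.sum_comm

theorem rmul_rmul (v : Matrix (Fin m) (Fin n) V) (α : Matrix (Fin n) (Fin r) ℂ)
    (β : Matrix (Fin r) (Fin l) ℂ) : rmul (rmul v α) β = rmul v (α * β) := by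
  ext i j
  simp only [rmul, of_apply, Matrix.mul_apply, Finset.smul_sum, Finset.sum_smul, mul_smul]
  rw [Finset.sum_comm]
  exact Finset.sum_congr rfl fun _ _ => Finset.sum_congr rfl fun _ _ => smul_comm ..

theorem lmul_rmul (α : Matrix (Fin r) (Fin m) ℂ) (v : Matrix (Fin m) (Fin n) V)
    (β : Matrix (Fin n) (Fin s) ℂ) : lmul α (rmul v β) = rmul (lmul α v) β := by
  ext i j
  simp only [lmul, rmul, of_apply, Finset.smul_sum]
  rw [Finset.sum_comm]
  exact Finset.sum_congr rfl fun _ _ => Finset.sum_congr rfl fun _ _ => smul_comm ..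

theorem smul_eq_lmul (c : ℂ) (v : Matrix (Fin m) (Fin n) V) : c • v = lmul (c • 1) v := by
  ext i j
  simp [lmul, Matrix.one_apply]

theorem submatrix_eq_lmul_rmul (v : Matrix (Fin m) (Fin n) V) (f : Fin r → Fin m)
    (g : Fin s → Fin n) :
    v.submatrix f g = lmul ((1 : Matrix (Fin m) (Fin m) ℂ).submatrix f id)
      (rmul v ((1 : Matrix (Fin n) (Fin n) ℂ).submatrix id g)) := by
  ext i j
  simp [lmul, rmul, Matrix.one_apply]

theorem single_eq_lmul_rmul (i : Fin m) (j : Fin n) (x : V) :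
    single i j x =
      lmul ((1 : Matrix (Fin m) (Fin m) ℂ).submatrix id fun _ : Fin 1 => i)
        (rmul (of fun _ _ : Fin 1 => x)
          ((1 : Matrix (Fin n) (Fin n) ℂ).submatrix (fun _ => j) id)) := by
  ext a b
  simp [lmul, rmul, Matrix.single_apply, Matrix.one_apply, ← ite_and, eq_comm, and_comm]

/-- The compression `α* v α`. -/
def compress (v : Matrix (Fin m) (Fin m) V) (α : Matrix (Fin m) (Fin n) ℂ) :
    Matrix (Fin n) (Fin n) V :=
  lmul αᴴ (rmul v α)

theorem compress_compress (v : Matrix (Fin m) (Fin m) V) (α : Matrix (Fin m) (Fin n) ℂ)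
    (β : Matrix (Fin n) (Fin r) ℂ) : compress (compress v α) β = compress v (α * β) := by
  simp only [compress, lmul_rmul, rmul_rmul, lmul_lmul, conjTranspose_mul]

theorem compress_one (v : Matrix (Fin m) (Fin m) V) : compress v 1 = v := by
  rw [compress, conjTranspose_one, lmul_one, rmul_one]

theorem compress_apply (v : Matrix (Fin m) (Fin m) V) (α : Matrix (Fin m) (Fin n) ℂ)
    (i j : Fin n) : compress v α i j = ∑ k, ∑ l, (star (α k i) * α l j) • v k l := by
  simp [compress, lmul, rmul, Finset.smul_sum, mul_smul]

theorem compress_zero (α : Matrix (Fin m) (Fin n) ℂ) :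
    compress (0 : Matrix (Fin m) (Fin m) V) α = 0 := by
  ext i j
  simp [compress_apply]

theorem compress_sub (v w : Matrix (Fin m) (Fin m) V) (α : Matrix (Fin m) (Fin n) ℂ) :
    compress (v - w) α = compress v α - compress w α := by
  ext i j
  simp [compress_apply, smul_sub]

theorem compress_smul (c : ℂ) (v : Matrix (Fin m) (Fin m) V) (α : Matrix (Fin m) (Fin n) ℂ) :
    compress (c • v) α = c • compress v α := by
  ext i j
  simp [compress_apply, Finset.smul_sum, smul_comm c]

theorem compress_smul_right {c : ℂ} (hc : star c * c = 1) (v : Matrix (Fin m) (Fin m) V)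
    (α : Matrix (Fin m) (Fin n) ℂ) : compress v (c • α) = compress v α := by
  ext i j
  simp only [compress_apply, Matrix.smul_apply, smul_eq_mul, star_mul', mul_mul_mul_comm, hc,
    one_mul]

theorem compress_unitMat (e : V) (α : Matrix (Fin m) (Fin n) ℂ) :
    compress (unitMat e m) α = of fun i j => (αᴴ * α) i j • e := by
  ext i j
  simp [compress_apply, unitMat, Matrix.diagonal_apply, Matrix.mul_apply, Finset.sum_smul]

theorem compress_unitMat_of_isometry (e : V) {α : Matrix (Fin m) (Fin n) ℂ} (h : αᴴ * α = 1) :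
    compress (unitMat e m) α = unitMat e n := by
  rw [compress_unitMat, h]
  ext i j
  by_cases hij : i = j <;> simp [unitMat, hij]

theorem submatrix_eq_compress (v : Matrix (Fin m) (Fin m) V) (f : Fin n → Fin m) :
    v.submatrix f f = compress v ((1 : Matrix (Fin m) (Fin m) ℂ).submatrix id f) := by
  rw [submatrix_eq_lmul_rmul, compress, conjTranspose_submatrix, conjTranspose_one]

theorem conjTranspose_mul_self_one_submatrix {f : Fin n → Fin m} (hf : Function.Injective f) :
    ((1 : Matrix (Fin m) (Fin m) ℂ).submatrix id f)ᴴ *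
      (1 : Matrix (Fin m) (Fin m) ℂ).submatrix id f = 1 := by
  rw [conjTranspose_submatrix, conjTranspose_one,
    ← submatrix_mul _ _ f id f Function.bijective_id, one_mul, submatrix_one f hf]

theorem one_submatrix_mul_conjTranspose (σ : Fin n ≃ Fin m) :
    (1 : Matrix (Fin m) (Fin m) ℂ).submatrix id σ *
      ((1 : Matrix (Fin m) (Fin m) ℂ).submatrix id σ)ᴴ = 1 := by
  rw [conjTranspose_submatrix, conjTranspose_one, submatrix_mul_equiv, one_mul, submatrix_id_id]

variable [StarAddMonoid V] [StarModule ℂ V]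

theorem conjTranspose_lmul (α : Matrix (Fin r) (Fin m) ℂ) (v : Matrix (Fin m) (Fin n) V) :
    (lmul α v)ᴴ = rmul vᴴ αᴴ := by
  ext i j
  simp [lmul, rmul, star_sum, star_smul]

theorem conjTranspose_rmul (v : Matrix (Fin m) (Fin n) V) (α : Matrix (Fin n) (Fin s) ℂ) :
    (rmul v α)ᴴ = lmul αᴴ vᴴ := by
  ext i j
  simp [lmul, rmul, star_sum, star_smul]

theorem conjTranspose_compress (v : Matrix (Fin m) (Fin m) V) (α : Matrix (Fin m) (Fin n) ℂ) :
    (compress v α)ᴴ = compress vᴴ α := by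
  rw [compress, conjTranspose_lmul, conjTranspose_rmul, conjTranspose_conjTranspose, compress,
    lmul_rmul]

end Scalar

section Blocks

variable {V : Type*} [AddCommGroup V] {m n r s : ℕ}

theorem block_add_block (a a' : Matrix (Fin m) (Fin n) V) (b b' : Matrix (Fin m) (Fin s) V)
    (c c' : Matrix (Fin r) (Fin n) V) (d d' : Matrix (Fin r) (Fin s) V) :
    block a b c d + block a' b' c' d' = block (a + a') (b + b') (c + c') (d + d') := by
  ext i j
  cases i using Fin.addCases <;> cases j using Fin.addCases <;> simp [block]

theorem smul_block [Module ℂ V] (k : ℂ) (a : Matrix (Fin m) (Fin n) V)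
    (b : Matrix (Fin m) (Fin s) V) (c : Matrix (Fin r) (Fin n) V) (d : Matrix (Fin r) (Fin s) V) :
    k • block a b c d = block (k • a) (k • b) (k • c) (k • d) := by
  ext i j
  cases i using Fin.addCases <;> cases j using Fin.addCases <;> simp [block]

theorem oplus_add_oplus (v v' : Matrix (Fin m) (Fin n) V) (w w' : Matrix (Fin r) (Fin s) V) :
    oplus v w + oplus v' w' = oplus (v + v') (w + w') := by
  simp only [oplus, block_add_block, add_zero]

theorem oplus_zero_zero :
    oplus (0 : Matrix (Fin m) (Fin n) V) (0 : Matrix (Fin r) (Fin s) V) = 0 := by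
  ext i j
  cases i using Fin.addCases <;> cases j using Fin.addCases <;> simp [oplus, block]

theorem oplus_inj {v v' : Matrix (Fin m) (Fin n) V} {w w' : Matrix (Fin r) (Fin s) V} :
    oplus v w = oplus v' w' ↔ v = v' ∧ w = w' := by
  refine ⟨fun h => ⟨?_, ?_⟩, fun ⟨hv, hw⟩ => hv ▸ hw ▸ rfl⟩
  · ext i j
    simpa [oplus, block] using congrFun₂ h (Fin.castAdd r i) (Fin.castAdd s j)
  · ext i j
    simpa [oplus, block] using congrFun₂ h (Fin.natAdd m i) (Fin.natAdd n j)

theorem oplus_submatrix_finAddFlip (v : Matrix (Fin m) (Fin n) V) (w : Matrix (Fin r) (Fin s) V) :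
    (oplus v w).submatrix finAddFlip finAddFlip = oplus w v := by
  ext i j
  cases i using Fin.addCases <;> cases j using Fin.addCases <;>
    simp [oplus, block, -Fin.natAdd_eq_addNat]

theorem block_zero_diag (v : Matrix (Fin m) (Fin n) V) (w : Matrix (Fin n) (Fin m) V) :
    block 0 v w 0 = (oplus v w).submatrix id finAddFlip := by
  ext i j
  cases i using Fin.addCases <;> cases j using Fin.addCases <;>
    simp [oplus, block, -Fin.natAdd_eq_addNat]

theorem compress_block_oplus [Module ℂ V] (a : Matrix (Fin m) (Fin m) V)
    (b : Matrix (Fin m) (Fin n) V) (c : Matrix (Fin n) (Fin m) V) (d : Matrix (Fin n) (Fin n) V)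
    (α : Matrix (Fin m) (Fin r) ℂ) (β : Matrix (Fin n) (Fin s) ℂ) :
    compress (block a b c d) (oplus α β) =
      block (compress a α) (lmul αᴴ (rmul b β)) (lmul βᴴ (rmul c α)) (compress d β) := by
  ext i j
  cases i using Fin.addCases <;> cases j using Fin.addCases <;>
    simp [compress, lmul, rmul, oplus, block, Fin.sum_univ_add]

theorem oplus_zero_eq_compress [Module ℂ V] (v : Matrix (Fin m) (Fin m) V) (n : ℕ) :
    oplus v (0 : Matrix (Fin n) (Fin n) V) =
      compress v ((1 : Matrix (Fin (m + n)) (Fin (m + n)) ℂ).submatrix (Fin.castAdd n) id) := by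
  have disjoint (a : Fin m) (b : Fin n) : Fin.castAdd n a ≠ Fin.natAdd m b := by
    simp only [ne_eq, Fin.ext_iff, Fin.val_castAdd, Fin.val_natAdd]
    omega
  ext i j
  cases i using Fin.addCases <;> cases j using Fin.addCases <;>
    simp [oplus, block, compress_apply, Matrix.one_apply, disjoint]

theorem isHermitian_block [StarAddMonoid V] {a : Matrix (Fin m) (Fin m) V}
    {d : Matrix (Fin n) (Fin n) V} (ha : a.IsHermitian) (v : Matrix (Fin m) (Fin n) V)
    (hd : d.IsHermitian) : (block a v vᴴ d).IsHermitian :=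
  (IsHermitian.fromBlocks ha rfl hd).submatrix _

end Blocks

section Permutation

variable {V : Type*} {ι κ τ : Type*}

/-- Equality of square matrices up to a simultaneous relabelling of rows and columns. -/
def PermEq (x : Matrix ι ι V) (y : Matrix κ κ V) : Prop := ∃ σ : κ ≃ ι, y = x.submatrix σ σ

theorem PermEq.refl (x : Matrix ι ι V) : PermEq x x := ⟨Equiv.refl _, rfl⟩

theorem PermEq.symm {x : Matrix ι ι V} {y : Matrix κ κ V} (h : PermEq x y) : PermEq y x := by
  obtain ⟨σ, rfl⟩ := h
  exact ⟨σ.symm, by simp⟩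

theorem PermEq.trans {x : Matrix ι ι V} {y : Matrix κ κ V} {z : Matrix τ τ V} (h : PermEq x y)
    (h' : PermEq y z) : PermEq x z := by
  obtain ⟨σ, rfl⟩ := h
  obtain ⟨ρ, rfl⟩ := h'
  exact ⟨ρ.trans σ, submatrix_submatrix ..⟩

theorem PermEq.size_eq {m n : ℕ} {x : Matrix (Fin m) (Fin m) V} {y : Matrix (Fin n) (Fin n) V}
    (h : PermEq x y) : m = n := by
  obtain ⟨σ, -⟩ := h
  exact (Fin.equiv_iff_eq.1 ⟨σ⟩).symm

theorem permEq_castSq {m k : ℕ} (h : m = k) (v : Matrix (Fin m) (Fin m) V) :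
    PermEq v (castSq h v) := ⟨(finCongr h).symm, rfl⟩

variable [AddCommGroup V] {l m n : ℕ}

theorem permEq_oplus_fromBlocks (v : Matrix (Fin m) (Fin m) V) (w : Matrix (Fin n) (Fin n) V) :
    PermEq (oplus v w) (fromBlocks v 0 0 w) := ⟨finSumFinEquiv, by simp [oplus, block]⟩

theorem PermEq.fromBlocks {ι' κ' : Type*} {x : Matrix ι ι V} {y : Matrix κ κ V}
    {x' : Matrix ι' ι' V} {y' : Matrix κ' κ' V} (h : PermEq x y) (h' : PermEq x' y') :
    PermEq (fromBlocks x 0 0 x') (fromBlocks y 0 0 y') := by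
  obtain ⟨σ, rfl⟩ := h
  obtain ⟨ρ, rfl⟩ := h'
  refine ⟨Equiv.sumCongr σ ρ, ?_⟩
  ext (i | i) (j | j) <;> simp

theorem PermEq.oplus {m' n' : ℕ} {v : Matrix (Fin m) (Fin m) V} {v' : Matrix (Fin m') (Fin m') V}
    {w : Matrix (Fin n) (Fin n) V} {w' : Matrix (Fin n') (Fin n') V} (h : PermEq v v')
    (h' : PermEq w w') : PermEq (oplus v w) (oplus v' w') :=
  (permEq_oplus_fromBlocks v w).trans ((h.fromBlocks h').trans (permEq_oplus_fromBlocks v' w').symm)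

theorem permEq_oplus_comm (v : Matrix (Fin m) (Fin m) V) (w : Matrix (Fin n) (Fin n) V) :
    PermEq (oplus v w) (oplus w v) := ⟨finAddFlip, (oplus_submatrix_finAddFlip v w).symm⟩

theorem permEq_oplus_assoc (u : Matrix (Fin l) (Fin l) V) (v : Matrix (Fin m) (Fin m) V)
    (w : Matrix (Fin n) (Fin n) V) : PermEq (oplus (oplus u v) w) (oplus u (oplus v w)) := by
  have reassociate : PermEq (Matrix.fromBlocks (Matrix.fromBlocks u 0 0 v) 0 0 w)
      (Matrix.fromBlocks u 0 0 (Matrix.fromBlocks v 0 0 w)) := by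
    refine ⟨(Equiv.sumAssoc _ _ _).symm, ?_⟩
    ext (i | i | i) (j | j | j) <;> simp
  have left := (permEq_oplus_fromBlocks (AMOU.oplus u v) w).trans
    ((permEq_oplus_fromBlocks u v).fromBlocks (.refl w))
  have right := (permEq_oplus_fromBlocks u (AMOU.oplus v w)).trans
    ((PermEq.refl u).fromBlocks (permEq_oplus_fromBlocks v w))
  exact left.trans (reassociate.trans right.symm)

theorem permEq_oplus_right_comm (u : Matrix (Fin l) (Fin l) V) (v : Matrix (Fin m) (Fin m) V)
    (w : Matrix (Fin n) (Fin n) V) : PermEq (oplus (oplus u v) w) (oplus (oplus u w) v) :=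
  (permEq_oplus_assoc u v w).trans
    (((PermEq.refl u).oplus (permEq_oplus_comm v w)).trans (permEq_oplus_assoc u w v).symm)

end Permutation

section AbsoluteValue

theorem opNorm_le_one {r m : ℕ} {α : Matrix (Fin r) (Fin m) ℂ} (h : αᴴ * α = 1) :
    opNorm α ≤ 1 := by
  open scoped Matrix.Norms.L2Operator in
  have norm_sq_le_one : ‖α‖ ^ 2 ≤ 1 := by
    rw [sq, ← l2_opNorm_conjTranspose_mul_self, h]
    rcases isEmpty_or_nonempty (Fin m) with _ | _
    · rw [Subsingleton.elim (1 : Matrix (Fin m) (Fin m) ℂ) 0, norm_zero]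
      exact zero_le_one
    · exact CStarRing.norm_one.le
  exact (sq_le_one_iff₀ (norm_nonneg _)).1 norm_sq_le_one

theorem opNorm_conjTranspose {r m : ℕ} (α : Matrix (Fin r) (Fin m) ℂ) :
    opNorm αᴴ = opNorm α :=
  l2_opNorm_conjTranspose α

variable {V : Type*} [AddCommGroup V] [Module ℂ V] [StarAddMonoid V]
  {m n r s : ℕ} [NeZero m] [NeZero n] [NeZero r] [NeZero s]

namespace MatrixOrderedSpace

variable (S : MatrixOrderedSpace V) {u v w : Matrix (Fin n) (Fin n) V}

theorem isHermitian_of_mem_pos (hv : v ∈ S.pos n) : v.IsHermitian :=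
  S.isHermitian_of_mem n (NeZero.pos n) v hv

theorem add_mem_pos (hv : v ∈ S.pos n) (hw : w ∈ S.pos n) : v + w ∈ S.pos n :=
  S.add_mem n (NeZero.pos n) v hv w hw

theorem smul_mem_pos {k : ℝ} (hk : 0 ≤ k) (hv : v ∈ S.pos n) : (k : ℂ) • v ∈ S.pos n :=
  S.smul_mem n (NeZero.pos n) k hk v hv

theorem compress_mem_pos (hv : v ∈ S.pos n) (α : Matrix (Fin n) (Fin m) ℂ) :
    compress v α ∈ S.pos m :=
  S.conj_mem n m (NeZero.pos n) (NeZero.pos m) v hv α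

theorem sub_mem_pos_trans (huv : u - v ∈ S.pos n) (hvw : v - w ∈ S.pos n) : u - w ∈ S.pos n :=
  sub_add_sub_cancel u v w ▸ S.add_mem_pos huv hvw

end MatrixOrderedSpace

-- Polarisation: compressing to the vectors `eᵢ + c eⱼ` with `c = 0, 1, i` recovers all entries.
theorem MatrixOrderUnitSpace.eq_zero_of_mem_pos_of_neg_mem_pos (S : MatrixOrderUnitSpace V)
    {v : Matrix (Fin n) (Fin n) V} (hv : v ∈ S.pos n) (hv' : -v ∈ S.pos n) : v = 0 := by
  have compress_eq_zero (a : Matrix (Fin n) (Fin 1) ℂ) : compress v a = 0 := by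
    refine S.proper _ (S.compress_mem_pos hv a) ?_
    rw [← zero_sub, ← compress_zero a, ← compress_sub, zero_sub]
    exact S.compress_mem_pos hv' a
  have quadratic_form_eq_zero (i j : Fin n) (c : ℂ) :
      v i i + c • v i j + (star c • v j i + (star c * c) • v j j) = 0 := by
    have := congrFun₂ (compress_eq_zero
      (of fun k _ => (if k = i then 1 else 0) + if k = j then c else 0)) 0 0
    simp only [compress, lmul, rmul, of_apply, conjTranspose_apply, add_smul, star_add,
      Finset.sum_add_distrib, ite_smul, zero_smul, apply_ite star, star_zero, star_one, one_smul,
      Finset.sum_ite_eq', Finset.mem_univ, if_true, Matrix.zero_apply, smul_add] at this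
    rw [← this, mul_smul]
    abel
  have diagonal_eq_zero (i : Fin n) : v i i = 0 := by simpa using quadratic_form_eq_zero i i 0
  ext i j
  have add_eq_zero : v i j + v j i = 0 := by
    simpa [diagonal_eq_zero] using quadratic_form_eq_zero i j 1
  have smul_sub_eq_zero : Complex.I • (v i j - v j i) = 0 := by
    simpa [diagonal_eq_zero, ← sub_eq_add_neg, ← smul_sub] using
      quadratic_form_eq_zero i j Complex.I
  have symmetric : v i j = v j i :=
    sub_eq_zero.1 ((smul_eq_zero_iff_right Complex.I_ne_zero).1 smul_sub_eq_zero)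
  rw [← symmetric, ← two_smul ℂ] at add_eq_zero
  exact (smul_eq_zero_iff_right two_ne_zero).1 add_eq_zero

namespace AbsMatrixOrderUnitSpace

variable (S : AbsMatrixOrderUnitSpace V)

theorem unitMat_mem_pos : unitMat S.e n ∈ S.pos n := S.unit_mem_pos (NeZero.pos n)

theorem isHermitian_unitMat : (unitMat S.e n).IsHermitian :=
  S.isHermitian_of_mem_pos S.unitMat_mem_pos

theorem eq_of_sub_mem_pos {v w : Matrix (Fin n) (Fin n) V} (h : v - w ∈ S.pos n)
    (h' : w - v ∈ S.pos n) : v = w :=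
  sub_eq_zero.1 (S.eq_zero_of_mem_pos_of_neg_mem_pos h (by rwa [neg_sub]))

theorem abs_mem_pos (v : Matrix (Fin m) (Fin n) V) : S.abs m n v ∈ S.pos n :=
  S.abs_mem m n (NeZero.pos m) (NeZero.pos n) v

theorem isAbsolutelyOrdered_hermitian :
    IsAbsolutelyOrdered {v : Matrix (Fin n) (Fin n) V | v.IsHermitian} (S.pos n) (S.abs n n) :=
  S.isAbsolutelyOrdered n (NeZero.pos n)

theorem abs_of_mem_pos {v : Matrix (Fin n) (Fin n) V} (hv : v ∈ S.pos n) : S.abs n n v = v :=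
  S.isAbsolutelyOrdered_hermitian.abs_of_mem v hv

theorem abs_oplus_eq (v : Matrix (Fin m) (Fin n) V) (w : Matrix (Fin r) (Fin s) V) :
    S.abs (m + r) (n + s) (oplus v w) = oplus (S.abs m n v) (S.abs r s w) :=
  S.abs_oplus m n r s (NeZero.pos m) (NeZero.pos n) (NeZero.pos r) (NeZero.pos s) v w

theorem add_unit_sub_abs_of_mem_pos {v : Matrix (Fin n) (Fin n) V} (hv : v ∈ S.pos n) :
    v + unitMat S.e n - S.abs n n v = unitMat S.e n := by
  rw [S.abs_of_mem_pos hv, add_sub_cancel_left]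

theorem add_unit_sub_abs_oplus (v : Matrix (Fin m) (Fin m) V) (w : Matrix (Fin n) (Fin n) V) :
    oplus v w + unitMat S.e (m + n) - S.abs (m + n) (m + n) (oplus v w) =
      oplus (v + unitMat S.e m - S.abs m m v) (w + unitMat S.e n - S.abs n n w) := by
  rw [S.abs_oplus_eq, ← oplus_unitMat, oplus_add_oplus, oplus_sub_oplus]

omit [NeZero n] in
theorem add_unit_sub_abs_of_mem_U {u : Matrix (Fin n) (Fin n) V} (hu : u ∈ S.U n) :
    u + unitMat S.e n - S.abs n n u = u := by
  rw [hu.1, add_sub_cancel_right]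

theorem oplus_mem_pos {v : Matrix (Fin m) (Fin m) V} {w : Matrix (Fin n) (Fin n) V}
    (hv : v ∈ S.pos m) (hw : w ∈ S.pos n) : oplus v w ∈ S.pos (m + n) := by
  rw [← S.abs_of_mem_pos hv, ← S.abs_of_mem_pos hw, ← S.abs_oplus_eq]
  exact S.abs_mem_pos _

theorem abs_rmul_sub_abs_lmul_rmul_mem_pos {α : Matrix (Fin r) (Fin m) ℂ} (hα : opNorm α ≤ 1)
    (v : Matrix (Fin m) (Fin n) V) (β : Matrix (Fin n) (Fin s) ℂ) :
    S.abs n s (rmul (S.abs m n v) β) - S.abs r s (lmul α (rmul v β)) ∈ S.pos s := by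
  refine S.sub_mem_pos_trans ?_ (S.abs_mul_le r m n s (NeZero.pos r) (NeZero.pos m) (NeZero.pos n)
    (NeZero.pos s) α v β)
  have := S.smul_mem_pos (sub_nonneg.2 hα) (S.abs_mem_pos (rmul (S.abs m n v) β))
  simpa [sub_smul] using this

theorem abs_sub_abs_lmul_mem_pos {α : Matrix (Fin r) (Fin m) ℂ} (hα : opNorm α ≤ 1)
    (v : Matrix (Fin m) (Fin n) V) : S.abs m n v - S.abs r n (lmul α v) ∈ S.pos n := by
  have := S.abs_rmul_sub_abs_lmul_rmul_mem_pos hα v (1 : Matrix (Fin n) (Fin n) ℂ)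
  rwa [rmul_one, rmul_one, S.abs_of_mem_pos (S.abs_mem_pos v)] at this

theorem abs_lmul_of_isometry {α : Matrix (Fin r) (Fin m) ℂ} (hα : αᴴ * α = 1)
    (v : Matrix (Fin m) (Fin n) V) : S.abs r n (lmul α v) = S.abs m n v := by
  have hα_le := opNorm_le_one hα
  have back := S.abs_sub_abs_lmul_mem_pos ((opNorm_conjTranspose α).trans_le hα_le) (lmul α v)
  rw [lmul_lmul, hα, lmul_one] at back
  exact S.eq_of_sub_mem_pos back (S.abs_sub_abs_lmul_mem_pos hα_le v)

theorem abs_neg (v : Matrix (Fin m) (Fin n) V) : S.abs m n (-v) = S.abs m n v := by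
  have := S.abs_lmul_of_isometry (α := (-1 : ℂ) • (1 : Matrix (Fin m) (Fin m) ℂ)) (by simp) v
  rwa [← smul_eq_lmul, neg_one_smul] at this

theorem abs_rmul_of_mem_pos {β : Matrix (Fin n) (Fin s) ℂ} (hβ : β * βᴴ = 1)
    {v : Matrix (Fin n) (Fin n) V} (hv : v ∈ S.pos n) :
    S.abs n s (rmul v β) = compress v β := by
  rw [← S.abs_lmul_of_isometry (α := βᴴ) (by rwa [conjTranspose_conjTranspose]) (rmul v β)]
  exact S.abs_of_mem_pos (S.compress_mem_pos hv β)

theorem compress_abs_sub_abs_rmul_mem_pos {β : Matrix (Fin n) (Fin s) ℂ} (hβ : β * βᴴ = 1)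
    (v : Matrix (Fin m) (Fin n) V) :
    compress (S.abs m n v) β - S.abs m s (rmul v β) ∈ S.pos s := by
  have opNorm_one := opNorm_le_one (α := (1 : Matrix (Fin m) (Fin m) ℂ)) (by simp)
  have := S.abs_rmul_sub_abs_lmul_rmul_mem_pos opNorm_one v β
  rwa [lmul_one, S.abs_rmul_of_mem_pos hβ (S.abs_mem_pos v)] at this

theorem abs_rmul_of_unitary {β : Matrix (Fin n) (Fin s) ℂ} (hβ : β * βᴴ = 1) (hβ' : βᴴ * β = 1)
    (v : Matrix (Fin m) (Fin n) V) : S.abs m s (rmul v β) = compress (S.abs m n v) β := by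
  refine S.eq_of_sub_mem_pos ?_ (S.compress_abs_sub_abs_rmul_mem_pos hβ v)
  have back := S.compress_abs_sub_abs_rmul_mem_pos (β := βᴴ)
    (by rwa [conjTranspose_conjTranspose]) (rmul v β)
  rw [rmul_rmul, hβ, rmul_one] at back
  have := S.compress_mem_pos back β
  rwa [compress_sub, compress_compress, hβ', compress_one] at this

theorem abs_compress {α : Matrix (Fin n) (Fin s) ℂ} (hα : α * αᴴ = 1) (hα' : αᴴ * α = 1)
    (v : Matrix (Fin n) (Fin n) V) : S.abs s s (compress v α) = compress (S.abs n n v) α := by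
  rw [compress, S.abs_lmul_of_isometry (by rwa [conjTranspose_conjTranspose]),
    S.abs_rmul_of_unitary hα hα']

theorem abs_submatrix (σ : Fin r ≃ Fin m) (τ : Fin s ≃ Fin n) (v : Matrix (Fin m) (Fin n) V) :
    S.abs r s (v.submatrix σ τ) = (S.abs m n v).submatrix τ τ := by
  have isometry : ((1 : Matrix (Fin m) (Fin m) ℂ).submatrix σ id)ᴴ *
      ((1 : Matrix (Fin m) (Fin m) ℂ).submatrix σ id) = 1 := by
    rw [conjTranspose_submatrix, conjTranspose_one, submatrix_mul_equiv, one_mul, submatrix_id_id]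
  rw [submatrix_eq_lmul_rmul v, submatrix_eq_compress, S.abs_lmul_of_isometry isometry,
    S.abs_rmul_of_unitary (one_submatrix_mul_conjTranspose τ)
      (conjTranspose_mul_self_one_submatrix τ.injective)]

theorem abs_dilation (v : Matrix (Fin m) (Fin n) V) :
    S.abs (m + n) (m + n) (block 0 v vᴴ 0) = oplus (S.abs n m vᴴ) (S.abs m n v) := by
  rw [block_zero_diag, ← Equiv.coe_refl, S.abs_submatrix, S.abs_oplus_eq,
    oplus_submatrix_finAddFlip]

end AbsMatrixOrderUnitSpace

end AbsoluteValue

section Orthogonality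

variable {V : Type*} [AddCommGroup V] [Module ℂ V] [StarAddMonoid V] {n : ℕ} [NeZero n]

namespace AbsMatrixOrderUnitSpace

variable (S : AbsMatrixOrderUnitSpace V) {p u v w : Matrix (Fin n) (Fin n) V}

/-- Orthogonality `u ⊥ v`, expressed through the absolute value. -/
def Perp (u v : Matrix (Fin n) (Fin n) V) : Prop := S.abs n n (u - v) = u + v

variable {S}

theorem Perp.symm (h : S.Perp u v) : S.Perp v u := by
  rw [Perp, ← neg_sub, S.abs_neg, add_comm]
  exact h

theorem perp_add_right_iff (hu : u ∈ S.pos n) (hv : v ∈ S.pos n) (hw : w ∈ S.pos n) :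
    S.Perp u (v + w) ↔ S.Perp u v ∧ S.Perp u w := by
  have hu' := S.isHermitian_of_mem_pos hu
  have hv' := S.isHermitian_of_mem_pos hv
  have hw' := S.isHermitian_of_mem_pos hw
  have hvw := S.add_mem_pos hv hw
  have hvw' := S.isHermitian_of_mem_pos hvw
  have ord := S.isAbsolutelyOrdered_hermitian (n := n)
  refine ⟨fun h => ⟨?_, ?_⟩, fun ⟨h, h'⟩ => ?_⟩
  · exact ord.perp_of_le u hu' _ hvw' v hv' h hv (by rwa [add_sub_cancel_left])
  · exact ord.perp_of_le u hu' _ hvw' w hw' h hw (by rwa [add_sub_cancel_right])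
  · have := ord.perp_abs_add u hu' v hv' w hw' h h'
    rwa [S.abs_of_mem_pos hvw] at this

theorem perp_add_left_iff (hu : u ∈ S.pos n) (hv : v ∈ S.pos n) (hw : w ∈ S.pos n) :
    S.Perp (u + v) w ↔ S.Perp u w ∧ S.Perp v w := by
  have comm {x y : Matrix (Fin n) (Fin n) V} : S.Perp x y ↔ S.Perp y x := ⟨.symm, .symm⟩
  rw [comm, perp_add_right_iff hw hu hv, comm, comm (x := w)]

variable (S) in
theorem exists_pos_parts (hv : v.IsHermitian) :
    ∃ a ∈ S.pos n, ∃ b ∈ S.pos n, v = a - b ∧ S.abs n n v = a + b := by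
  have ord := S.isAbsolutelyOrdered_hermitian (n := n)
  have half : (0 : ℝ) ≤ 1 / 2 := by norm_num
  refine ⟨_, S.smul_mem_pos half (ord.abs_add_mem v hv), _,
    S.smul_mem_pos half (ord.abs_sub_mem v hv), ?_, ?_⟩ <;>
  · push_cast
    module

theorem Perp.abs_add (hu : u.IsHermitian) (hv : v.IsHermitian)
    (h : S.Perp (S.abs n n u) (S.abs n n v)) :
    S.abs n n (u + v) = S.abs n n u + S.abs n n v := by
  obtain ⟨a, ha, b, hb, rfl, hab⟩ := S.exists_pos_parts hu
  obtain ⟨c, hc, d, hd, rfl, hcd⟩ := S.exists_pos_parts hv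
  rw [hab, hcd, perp_add_left_iff ha hb (S.add_mem_pos hc hd), perp_add_right_iff ha hc hd,
    perp_add_right_iff hb hc hd] at h
  obtain ⟨⟨-, had⟩, hbc, -⟩ := h
  have : S.Perp (a + c) (b + d) := by
    rw [perp_add_left_iff ha hc (S.add_mem_pos hb hd), perp_add_right_iff ha hb hd,
      perp_add_right_iff hc hb hd]
    exact ⟨⟨hab, had⟩, hbc.symm, hcd⟩
  rw [hab, hcd, add_add_add_comm, ← this, add_sub_add_comm]

omit [NeZero n] in
theorem mem_OP_iff_perp :
    p ∈ S.OP n ↔ p.IsHermitian ∧ S.Perp p (unitMat S.e n - p) := by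
  rw [Perp, add_sub_cancel, ← sub_add, sub_add_eq_add_sub, ← two_smul ℂ]
  rfl

theorem unit_sub_mem_OP (hp : p ∈ S.OP n) : unitMat S.e n - p ∈ S.OP n := by
  obtain ⟨hermitian, perp⟩ := mem_OP_iff_perp.1 hp
  refine mem_OP_iff_perp.2 ⟨S.isHermitian_unitMat.sub hermitian, ?_⟩
  rw [sub_sub_cancel]
  exact perp.symm

theorem mem_pos_of_mem_OP (hp : p ∈ S.OP n) : p ∈ S.pos n := by
  obtain ⟨hermitian, perp⟩ := mem_OP_iff_perp.1 hp
  have := S.isAbsolutelyOrdered_hermitian.abs_add_mem (p - (unitMat S.e n - p))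
    (hermitian.sub (S.isHermitian_unitMat.sub hermitian))
  rw [perp] at this
  convert S.smul_mem_pos (k := 1 / 2) (by norm_num) this using 1
  push_cast
  module

theorem mem_PU_of_mem_OP (hp : p ∈ S.OP n) : p ∈ S.PU n := by
  have := S.abs_of_mem_pos (mem_pos_of_mem_OP hp)
  exact ⟨by rw [hp.1], by rwa [this]⟩

theorem unit_mem_OP : unitMat S.e n ∈ S.OP n := by
  simpa using unit_sub_mem_OP (zero_mem_OP S (NeZero.pos n))

theorem mem_PU_of_mem_U (hu : u ∈ S.U n) : u ∈ S.PU n :=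
  ⟨hu.1.trans hu.2.symm, hu.1 ▸ unit_mem_OP⟩

-- In the dilations, `|u|` and `eⁿ - |u|` are orthogonal on both diagonal blocks.
theorem add_unit_sub_abs_mem_U (hu : u ∈ S.PU n) :
    u + unitMat S.e n - S.abs n n u ∈ S.U n := by
  obtain ⟨habs, hOP⟩ := hu
  set p := S.abs n n u
  set q := unitMat S.e n - p with hq
  have q_pos : q ∈ S.pos n := mem_pos_of_mem_OP (unit_sub_mem_OP hOP)
  have abs_dilation_u : S.abs (n + n) (n + n) (block 0 u uᴴ 0) = oplus p p := by
    rw [S.abs_dilation, ← habs]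
  have abs_dilation_q : S.abs (n + n) (n + n) (block 0 q qᴴ 0) = oplus q q := by
    rw [S.abs_dilation, S.isHermitian_of_mem_pos q_pos, S.abs_of_mem_pos q_pos]
  have perp : S.Perp (oplus p p) (oplus q q) := by
    rw [Perp, oplus_sub_oplus, S.abs_oplus_eq, (mem_OP_iff_perp.1 hOP).2, oplus_add_oplus]
  have abs_sum := Perp.abs_add (isHermitian_block isHermitian_zero u isHermitian_zero)
    (isHermitian_block isHermitian_zero q isHermitian_zero)
    (abs_dilation_u ▸ abs_dilation_q ▸ perp)
  rw [abs_dilation_u, abs_dilation_q, oplus_add_oplus, block_add_block, add_zero,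
    ← conjTranspose_add, S.abs_dilation, oplus_inj, hq, add_sub_cancel, ← add_sub_assoc] at abs_sum
  exact ⟨abs_sum.2, abs_sum.1⟩

end AbsMatrixOrderUnitSpace

end Orthogonality

section Compression

variable {V : Type*} [AddCommGroup V] [Module ℂ V] [StarAddMonoid V] [StarModule ℂ V]
  {n r : ℕ} [NeZero n] [NeZero r]

namespace AbsMatrixOrderUnitSpace

variable {S : AbsMatrixOrderUnitSpace V} {α : Matrix (Fin n) (Fin r) ℂ}

theorem compress_mem_OP (hα : α * αᴴ = 1) (hα' : αᴴ * α = 1) {p : Matrix (Fin n) (Fin n) V}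
    (hp : p ∈ S.OP n) : compress p α ∈ S.OP r := by
  refine ⟨by rw [conjTranspose_compress, hp.1], ?_⟩
  rw [← compress_unitMat_of_isometry S.e hα', ← compress_smul, ← compress_sub,
    S.abs_compress hα hα', hp.2]

theorem compress_mem_U (hα : α * αᴴ = 1) (hα' : αᴴ * α = 1) {u : Matrix (Fin n) (Fin n) V}
    (hu : u ∈ S.U n) : compress u α ∈ S.U r := by
  refine ⟨?_, ?_⟩
  · rw [S.abs_compress hα hα', hu.1, compress_unitMat_of_isometry S.e hα']
  · rw [conjTranspose_compress, S.abs_compress hα hα', hu.2, compress_unitMat_of_isometry S.e hα']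

theorem compress_mem_PU (hα : α * αᴴ = 1) (hα' : αᴴ * α = 1) {u : Matrix (Fin n) (Fin n) V}
    (hu : u ∈ S.PU n) : compress u α ∈ S.PU r := by
  refine ⟨?_, S.abs_compress hα hα' u ▸ compress_mem_OP hα hα' hu.2⟩
  rw [conjTranspose_compress, S.abs_compress hα hα', S.abs_compress hα hα', ← hu.1]

end AbsMatrixOrderUnitSpace

end Compression

section Norm

variable {V : Type*} [AddCommGroup V] [Module ℂ V] [StarAddMonoid V]
  {m n r s : ℕ}

namespace AbsMatrixOrderUnitSpace

variable (S : AbsMatrixOrderUnitSpace V)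

/-- The relation `‖v‖ ≤ k` for rectangular `v`, expressed through the order. -/
def NormBound (k : ℝ) (v : Matrix (Fin m) (Fin n) V) : Prop :=
  block ((k : ℂ) • unitMat S.e m) v vᴴ ((k : ℂ) • unitMat S.e n) ∈ S.pos (m + n)

theorem unitMat_sub_compress_mem_pos [NeZero s] {β : Matrix (Fin n) (Fin s) ℂ} (hβ : β * βᴴ = 1) :
    unitMat S.e s - compress (unitMat S.e n) β ∈ S.pos s := by
  set π := 1 - βᴴ * β with hπ
  have projection : πᴴ * π = π := by
    have idempotent : βᴴ * β * (βᴴ * β) = βᴴ * β := by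
      rw [Matrix.mul_assoc, ← Matrix.mul_assoc β, hβ, Matrix.one_mul]
    rw [hπ, conjTranspose_sub, conjTranspose_mul, conjTranspose_conjTranspose, conjTranspose_one,
      sub_mul, mul_sub, mul_sub, idempotent]
    simp
  convert S.compress_mem_pos (S.unitMat_mem_pos (n := s)) π using 1
  rw [compress_unitMat, compress_unitMat, projection, hπ]
  ext i j
  by_cases h : i = j <;> simp [unitMat, h, sub_smul]

variable {S}

theorem mnorm_nonneg (v : Matrix (Fin n) (Fin n) V) : 0 ≤ S.mnorm v :=
  Real.sInf_nonneg fun _ hx => hx.1.le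

theorem NormBound.add [NeZero n] {k k' : ℝ} {v w : Matrix (Fin m) (Fin n) V} (h : S.NormBound k v)
    (h' : S.NormBound k' w) : S.NormBound (k + k') (v + w) := by
  rw [NormBound, Complex.ofReal_add, add_smul, add_smul, conjTranspose_add, ← block_add_block]
  exact S.add_mem_pos h h'

variable [NeZero m] [NeZero n]

theorem normBound_zero {k : ℝ} (hk : 0 ≤ k) : S.NormBound k (0 : Matrix (Fin m) (Fin n) V) := by
  rw [NormBound, conjTranspose_zero]
  exact S.oplus_mem_pos (S.smul_mem_pos hk S.unitMat_mem_pos) (S.smul_mem_pos hk S.unitMat_mem_pos)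

theorem NormBound.mono {k k' : ℝ} {v : Matrix (Fin m) (Fin n) V} (h : S.NormBound k v)
    (hk : k ≤ k') : S.NormBound k' v := by
  simpa using h.add (normBound_zero (sub_nonneg.2 hk))

theorem normBound_of_abs_le {k : ℝ} {v : Matrix (Fin m) (Fin n) V}
    (h : (k : ℂ) • unitMat S.e n - S.abs m n v ∈ S.pos n)
    (h' : (k : ℂ) • unitMat S.e m - S.abs n m vᴴ ∈ S.pos m) : S.NormBound k v := by
  have bound := S.oplus_mem_pos h' h
  rw [← oplus_sub_oplus, ← S.abs_dilation] at bound
  have := S.add_mem_pos bound (S.isAbsolutelyOrdered_hermitian.abs_add_mem _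
    (isHermitian_block isHermitian_zero v isHermitian_zero))
  rwa [add_comm (S.abs _ _ _), sub_add_add_cancel, oplus, block_add_block, add_zero, zero_add,
    zero_add, add_zero] at this

variable (S) in
theorem exists_normBound_one (v : Matrix (Fin 1) (Fin 1) V) :
    ∃ k : ℝ, 0 ≤ k ∧ S.NormBound k v := by
  have abs_pos := S.abs_mem_pos v
  have abs_star_pos := S.abs_mem_pos vᴴ
  obtain ⟨k, hk, -, h⟩ :=
    S.orderUnit _ (S.isHermitian_of_mem_pos (S.add_mem_pos abs_pos abs_star_pos))
  refine ⟨k, hk.le, normBound_of_abs_le ?_ ?_⟩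
  · have := S.add_mem_pos h abs_star_pos
    rwa [← sub_sub, sub_add_cancel] at this
  · have := S.add_mem_pos h abs_pos
    rwa [add_comm (S.abs _ _ _), ← sub_sub, sub_add_cancel] at this

theorem mnorm_le {k : ℝ} (hk : 0 ≤ k) {v : Matrix (Fin n) (Fin n) V} (h : S.NormBound k v) :
    S.mnorm v ≤ k :=
  le_of_forall_gt_imp_ge_of_dense fun _ hl =>
    csInf_le ⟨0, fun _ hx => hx.1.le⟩ ⟨hk.trans_lt hl, h.mono hl.le⟩

theorem mnorm_zero : S.mnorm (0 : Matrix (Fin n) (Fin n) V) = 0 :=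
  (mnorm_le le_rfl (normBound_zero le_rfl)).antisymm (mnorm_nonneg _)

variable [NeZero r] [NeZero s] [StarModule ℂ V]

omit [NeZero m] in
theorem NormBound.lmul_rmul {k : ℝ} (hk : 0 ≤ k) {v : Matrix (Fin m) (Fin n) V}
    (h : S.NormBound k v) {α : Matrix (Fin r) (Fin m) ℂ} (hα : αᴴ * α = 1)
    {β : Matrix (Fin n) (Fin s) ℂ} (hβ : β * βᴴ = 1) :
    S.NormBound k (lmul α (rmul v β)) := by
  have compressed := S.compress_mem_pos h (oplus αᴴ β)
  have complement := S.oplus_mem_pos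
    (S.smul_mem_pos hk (S.unitMat_sub_compress_mem_pos (β := αᴴ) (by simpa)))
    (S.smul_mem_pos hk (S.unitMat_sub_compress_mem_pos hβ))
  rw [compress_block_oplus, conjTranspose_conjTranspose, compress_smul, compress_smul]
    at compressed
  convert S.add_mem_pos compressed complement using 1
  rw [NormBound, oplus, block_add_block, ← smul_add, ← smul_add, add_sub_cancel, add_sub_cancel,
    add_zero, add_zero, AMOU.lmul_rmul, conjTranspose_rmul, conjTranspose_lmul,
    ← AMOU.lmul_rmul]

theorem NormBound.smul {k : ℝ} (hk : 0 ≤ k) {v : Matrix (Fin m) (Fin n) V}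
    (h : S.NormBound k v) (c : ℂ) : S.NormBound (‖c‖ * k) (c • v) := by
  set z := Complex.exp (c.arg * Complex.I) with hz
  have z_unimodular : star z * z = 1 := by
    have := Complex.conj_mul' z
    rwa [hz, Complex.norm_exp_ofReal_mul_I, Complex.ofReal_one, one_pow] at this
  have polar : (‖c‖ : ℂ) * z = c := Complex.norm_mul_exp_arg_mul_I c
  have real : star (‖c‖ : ℂ) = ‖c‖ := Complex.conj_ofReal _
  have rotated : S.NormBound k (z • v) := by
    rw [smul_eq_lmul, ← rmul_one v]
    refine h.lmul_rmul hk ?_ (by simp)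
    rw [conjTranspose_smul, smul_mul_smul_comm, z_unimodular, conjTranspose_one, mul_one, one_smul]
  have scaled := S.smul_mem_pos (norm_nonneg c) rotated
  rwa [smul_block, smul_smul (‖c‖ : ℂ) z, polar, ← real, ← conjTranspose_smul, real,
    smul_smul (‖c‖ : ℂ) z, polar, smul_smul, smul_smul, ← Complex.ofReal_mul] at scaled

variable (S) in
theorem exists_normBound (v : Matrix (Fin m) (Fin n) V) : ∃ k : ℝ, 0 ≤ k ∧ S.NormBound k v := by
  induction v using Matrix.induction_on' with
  | h_zero => exact ⟨0, le_rfl, normBound_zero le_rfl⟩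
  | h_add v w hv hw =>
    obtain ⟨k, hk, hv⟩ := hv
    obtain ⟨l, hl, hw⟩ := hw
    exact ⟨k + l, add_nonneg hk hl, hv.add hw⟩
  | h_std_basis i j x =>
    obtain ⟨k, hk, h⟩ := S.exists_normBound_one (of fun _ _ => x)
    refine ⟨k, hk, ?_⟩
    rw [single_eq_lmul_rmul]
    have injective {ι : Type} (a : ι) : Function.Injective fun _ : Fin 1 => a :=
      fun _ _ _ => Subsingleton.elim _ _
    refine h.lmul_rmul hk (conjTranspose_mul_self_one_submatrix (injective i)) ?_
    simpa using conjTranspose_mul_self_one_submatrix (injective j)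

variable (S) in
theorem normBound_mnorm (v : Matrix (Fin n) (Fin n) V) : S.NormBound (S.mnorm v) v := by
  have isHermitian_smul_unit := S.isHermitian_of_mem_pos
    (S.smul_mem_pos (mnorm_nonneg (S := S) v) (S.unitMat_mem_pos (n := n)))
  refine S.archimedean (n + n) (NeZero.pos _) _ S.unitMat_mem_pos _
    (isHermitian_block isHermitian_smul_unit v isHermitian_smul_unit) fun ε hε => ?_
  rw [← oplus_unitMat, smul_oplus, oplus, block_add_block, zero_add, zero_add, ← add_smul,
    ← Complex.ofReal_add]
  have nonempty : ∃ k : ℝ, 0 < k ∧ S.NormBound k v := by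
    obtain ⟨k, hk, h⟩ := S.exists_normBound v
    exact ⟨k + 1, by positivity, h.mono (by simp)⟩
  obtain ⟨k, ⟨-, hk⟩, lt⟩ := exists_lt_of_csInf_lt nonempty (lt_add_of_pos_left (S.mnorm v) hε)
  exact NormBound.mono hk lt.le

theorem mnorm_add_le (v w : Matrix (Fin n) (Fin n) V) :
    S.mnorm (v + w) ≤ S.mnorm v + S.mnorm w :=
  mnorm_le (add_nonneg (mnorm_nonneg v) (mnorm_nonneg w))
    ((S.normBound_mnorm v).add (S.normBound_mnorm w))

theorem mnorm_smul_le (c : ℂ) (v : Matrix (Fin n) (Fin n) V) :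
    S.mnorm (c • v) ≤ ‖c‖ * S.mnorm v :=
  mnorm_le (mul_nonneg (norm_nonneg c) (mnorm_nonneg v))
    ((S.normBound_mnorm v).smul (mnorm_nonneg v) c)

theorem mnorm_oplus_zero_le (v : Matrix (Fin m) (Fin m) V) :
    S.mnorm (oplus v (0 : Matrix (Fin n) (Fin n) V)) ≤ S.mnorm v := by
  refine mnorm_le (mnorm_nonneg v) ?_
  have isometry := conjTranspose_mul_self_one_submatrix (Fin.castAdd_injective m n)
  rw [oplus_zero_eq_compress]
  exact (S.normBound_mnorm v).lmul_rmul (mnorm_nonneg v) (by simpa using isometry)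
    (by simpa using isometry)

variable (S n) in
/-- `M_n(V)` with its matrix norm, which the axioms make a seminorm. -/
noncomputable abbrev seminormedGroup : SeminormedAddCommGroup (Matrix (Fin n) (Fin n) V) :=
  (Seminorm.ofSMulLE (𝕜 := ℂ) S.mnorm mnorm_zero mnorm_add_le
    mnorm_smul_le).toAddGroupSeminorm.toSeminormedAddCommGroup

variable (S n) in
/-- `M_n(V)` as a complex seminormed space. -/
noncomputable abbrev seminormedSpace :
    letI := S.seminormedGroup n; NormedSpace ℂ (Matrix (Fin n) (Fin n) V) :=
  letI := S.seminormedGroup n; ⟨mnorm_smul_le⟩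

end AbsMatrixOrderUnitSpace

end Norm

section UnitaryPath

open Metric

-- The path is the exponential one, available when `-1` avoids the spectrum of the rotated unitary.
theorem exists_joined_smul_one {A : Type*} [CStarAlgebra A] (u : unitary A)
    (hu : (spectrum ℂ (u : A)).Finite) : ∃ c : unitary ℂ, Joined (c • 1) u := by
  have infinite_circle : (sphere (0 : ℂ) 1).Infinite := by
    refine (isPreconnected_sphere ?_ 0 1).infinite_of_nontrivial ⟨1, by simp, -1, by simp, ?_⟩
    · rw [Complex.rank_real_complex]
      exact Cardinal.one_lt_two
    · norm_num
  obtain ⟨w, hw, notMem⟩ := infinite_circle.exists_notMem_finite hu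
  have conj_mul_self : starRingEnd ℂ w * w = 1 := by
    simp [Complex.conj_mul', mem_sphere_zero_iff_norm.1 hw]
  let c : unitary ℂ := ⟨-w, by simp [Unitary.mem_iff, mul_comm w, conj_mul_self]⟩
  have star_c_smul_w : Unitary.toUnits (star c) • w = -1 := by
    simp [Units.smul_def, c, conj_mul_self]
  refine ⟨c, Unitary.joined _ _ ?_⟩
  rw [Unitary.norm_sub_eq, Unitary.norm_sub_one_lt_two_iff (SetLike.coe_mem _), ← star_c_smul_w]
  have : ((u * star (c • 1) : unitary A) : A) = Unitary.toUnits (star c) • (u : A) := by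
    simp [Units.smul_def, Submonoid.smul_def]
  rwa [this, spectrum.smul_mem_smul_iff]

end UnitaryPath

section Homotopy

variable {V : Type*} [AddCommGroup V] [Module ℂ V] [StarAddMonoid V]
  {m n : ℕ}

/-- Closure of a set of square matrices under `v ↦ α* v α` for all unitary scalar matrices `α`. -/
def IsUnitarilyInvariant (A : Set (Matrix (Fin n) (Fin n) V)) : Prop :=
  ∀ α : Matrix (Fin n) (Fin n) ℂ, α * αᴴ = 1 → αᴴ * α = 1 → ∀ v ∈ A, compress v α ∈ A

namespace AbsMatrixOrderUnitSpace

variable (S : AbsMatrixOrderUnitSpace V)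

/-- Continuity of a map `M_m(V) → M_n(V)` for the matrix norms. -/
def MContinuous (F : Matrix (Fin m) (Fin m) V → Matrix (Fin n) (Fin n) V) : Prop :=
  ∀ v, ∀ ε : ℝ, 0 < ε → ∃ δ : ℝ, 0 < δ ∧ ∀ w, S.mnorm (w - v) < δ → S.mnorm (F w - F v) < ε

variable {S} {A : Set (Matrix (Fin n) (Fin n) V)} {u v w : Matrix (Fin n) (Fin n) V}

theorem Homotopic.map {B : Set (Matrix (Fin m) (Fin m) V)}
    {F : Matrix (Fin n) (Fin n) V → Matrix (Fin m) (Fin m) V} (hF : S.MContinuous F)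
    (hAB : ∀ x ∈ A, F x ∈ B) (h : S.Homotopic A u v) : S.Homotopic B (F u) (F v) := by
  obtain ⟨f, mem, continuous, rfl, rfl⟩ := h
  refine ⟨F ∘ f, fun t => hAB _ (mem t), fun t ε hε => ?_, rfl, rfl⟩
  obtain ⟨δ, hδ, hFδ⟩ := hF (f t) ε hε
  obtain ⟨η, hη, hfη⟩ := continuous t δ hδ
  exact ⟨η, hη, fun s hs => hFδ _ (hfη s hs)⟩

variable [StarModule ℂ V] [NeZero m] [NeZero n]

theorem homotopic_iff_joinedIn :
    S.Homotopic A u v ↔ letI := S.seminormedGroup n; JoinedIn A u v := by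
  let _ := S.seminormedGroup n
  have continuous_iff (f : unitInterval → Matrix (Fin n) (Fin n) V) : Continuous f ↔
      ∀ t, ∀ ε : ℝ, 0 < ε → ∃ δ : ℝ, 0 < δ ∧ ∀ s, dist s t < δ → S.mnorm (f s - f t) < ε := by
    simp only [Metric.continuous_iff, dist_eq_norm]
    rfl
  constructor
  · rintro ⟨f, mem, continuous, source, target⟩
    exact ⟨⟨⟨f, (continuous_iff f).2 continuous⟩, source, target⟩, mem⟩
  · rintro ⟨γ, mem⟩
    exact ⟨γ, mem, (continuous_iff γ).1 γ.continuous, γ.source, γ.target⟩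

theorem Homotopic.symm (h : S.Homotopic A u v) : S.Homotopic A v u :=
  homotopic_iff_joinedIn.2 (letI := S.seminormedGroup n; (homotopic_iff_joinedIn.1 h).symm)

theorem Homotopic.trans (h : S.Homotopic A u v) (h' : S.Homotopic A v w) : S.Homotopic A u w :=
  homotopic_iff_joinedIn.2 (letI := S.seminormedGroup n
    (homotopic_iff_joinedIn.1 h).trans (homotopic_iff_joinedIn.1 h'))

theorem mContinuous_oplus_right (w : Matrix (Fin n) (Fin n) V) :
    S.MContinuous fun v : Matrix (Fin m) (Fin m) V => oplus v w := by
  refine fun v ε hε => ⟨ε, hε, fun v' h => lt_of_le_of_lt ?_ h⟩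
  rw [oplus_sub_oplus, sub_self]
  exact mnorm_oplus_zero_le _

theorem mContinuous_add_unit_sub_abs (h : S.AbsContinuous n) :
    S.MContinuous fun v : Matrix (Fin n) (Fin n) V => v + unitMat S.e n - S.abs n n v := by
  let _ := S.seminormedGroup n
  have continuous_abs : Continuous (S.abs n n) := by
    simp only [Metric.continuous_iff, dist_eq_norm]
    exact h
  have : Continuous fun v => v + unitMat S.e n - S.abs n n v := by fun_prop
  simp only [Metric.continuous_iff, dist_eq_norm] at this
  exact this

theorem continuous_compress (v : Matrix (Fin n) (Fin n) V) :
    letI := S.seminormedGroup n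
    Continuous fun α : Matrix (Fin n) (Fin n) ℂ => compress v α := by
  let _ := S.seminormedGroup n
  let _ := S.seminormedSpace n
  have expand (α : Matrix (Fin n) (Fin n) ℂ) : compress v α =
      ∑ i, ∑ j, ∑ k, ∑ l, (star (α k i) * α l j) • single i j (v k l) := by
    rw [matrix_eq_sum_single (compress v α)]
    simp only [compress_apply, ← singleAddMonoidHom_apply, map_sum]
    simp only [singleAddMonoidHom_apply, smul_single]
  simp only [expand]
  refine continuous_finsetSum _ fun i _ => continuous_finsetSum _ fun j _ =>
    continuous_finsetSum _ fun k _ => continuous_finsetSum _ fun l _ => ?_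
  have : Continuous fun α : Matrix (Fin n) (Fin n) ℂ => star (α k i) * α l j := by fun_prop
  exact this.smul continuous_const

theorem homotopic_compress (hA : IsUnitarilyInvariant A) (hv : v ∈ A)
    (α : unitaryGroup (Fin n) ℂ) : S.Homotopic A v (compress v α.1) := by
  open scoped Matrix.Norms.L2Operator in
  obtain ⟨c, ⟨γ⟩⟩ := exists_joined_smul_one (α : unitary (Matrix (Fin n) (Fin n) ℂ))
    (finite_spectrum _)
  have hc : compress v (c • 1 : unitaryGroup (Fin n) ℂ).1 = v := by
    rw [Unitary.coe_smul, Submonoid.smul_def]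
    exact (compress_smul_right c.2.1 v 1).trans (compress_one v)
  rw [homotopic_iff_joinedIn]
  let _ := S.seminormedGroup n
  exact ⟨(γ.map ((continuous_compress v).comp continuous_subtype_val)).cast hc.symm rfl,
    fun t => hA _ (γ t).2.2 (γ t).2.1 v hv⟩

theorem homotopic_of_permEq (hA : IsUnitarilyInvariant A) (hv : v ∈ A) (h : PermEq v w) :
    S.Homotopic A v w := by
  obtain ⟨σ, rfl⟩ := h
  rw [submatrix_eq_compress]
  exact homotopic_compress hA hv
    ⟨_, conjTranspose_mul_self_one_submatrix σ.injective, one_submatrix_mul_conjTranspose σ⟩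

end AbsMatrixOrderUnitSpace

end Homotopy

section Stabilisation

variable {V : Type*} [AddCommGroup V]

/-- A family of sets `A n ⊆ M_n(V)` with base points `b n ∈ A n`, closed under `⊕` and under unitary
equivalence: the setting in which `u ⊕ b a` is a stabilisation of `u`. -/
structure IsStableFamily [Module ℂ V] (A : ∀ n, Set (Matrix (Fin n) (Fin n) V))
    (b : ∀ n, Matrix (Fin n) (Fin n) V) : Prop where
  base_mem (n : ℕ) [NeZero n] : b n ∈ A n
  oplus_base (m n : ℕ) : oplus (b m) (b n) = b (m + n)
  oplus_mem {m n : ℕ} [NeZero m] [NeZero n] {u : Matrix (Fin m) (Fin m) V}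
    {v : Matrix (Fin n) (Fin n) V} : u ∈ A m → v ∈ A n → oplus u v ∈ A (m + n)
  isUnitarilyInvariant (n : ℕ) [NeZero n] : IsUnitarilyInvariant (A n)

/-- `x` is, up to a simultaneous permutation of rows and columns, `u ⊕ b a` for some `a > 0`. -/
def PadsTo (b : ∀ n, Matrix (Fin n) (Fin n) V) {m k : ℕ} (u : Matrix (Fin m) (Fin m) V)
    (x : Matrix (Fin k) (Fin k) V) : Prop :=
  ∃ a, 0 < a ∧ PermEq (oplus u (b a)) x

variable {A : ∀ n, Set (Matrix (Fin n) (Fin n) V)} {b : ∀ n, Matrix (Fin n) (Fin n) V}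
  {k l m n : ℕ} {u : Matrix (Fin m) (Fin m) V} {v : Matrix (Fin n) (Fin n) V}
  {x : Matrix (Fin k) (Fin k) V}

theorem PermEq.padsTo (h : PermEq u v) (hv : PadsTo b v x) : PadsTo b u x := by
  obtain ⟨a, ha, hx⟩ := hv
  exact ⟨a, ha, (h.oplus (.refl _)).trans hx⟩

theorem PadsTo.lt (h : PadsTo b u x) : m < k := by
  obtain ⟨a, ha, hx⟩ := h
  have := hx.size_eq
  lia

theorem PadsTo.neZero [NeZero m] (h : PadsTo b u x) : NeZero k :=
  .of_pos ((NeZero.pos m).trans h.lt)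

theorem PadsTo.permEq {y : Matrix (Fin k) (Fin k) V} (hx : PadsTo b u x) (hy : PadsTo b u y) :
    PermEq x y := by
  obtain ⟨a, -, hx⟩ := hx
  obtain ⟨c, -, hy⟩ := hy
  obtain rfl : a = c := by
    have := hx.size_eq
    have := hy.size_eq
    lia
  exact hx.symm.trans hy

theorem PadsTo.oplus_right (h : PadsTo b u x) (v : Matrix (Fin n) (Fin n) V) :
    PadsTo b (oplus u v) (oplus x v) := by
  obtain ⟨a, ha, hx⟩ := h
  exact ⟨a, ha, (permEq_oplus_right_comm u v (b a)).trans (hx.oplus (.refl v))⟩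

variable [Module ℂ V]

namespace IsStableFamily

theorem mem_of_permEq (hA : IsStableFamily A b) [NeZero m] (hu : u ∈ A m) (h : PermEq u v) :
    v ∈ A n := by
  obtain rfl := h.size_eq
  obtain ⟨σ, rfl⟩ := h
  rw [submatrix_eq_compress]
  exact hA.isUnitarilyInvariant m _ (one_submatrix_mul_conjTranspose σ)
    (conjTranspose_mul_self_one_submatrix σ.injective) u hu

theorem mem_of_padsTo (hA : IsStableFamily A b) [NeZero m] (hu : u ∈ A m) (h : PadsTo b u x) :
    x ∈ A k := by
  obtain ⟨a, ha, hx⟩ := h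
  have : NeZero a := .of_pos ha
  exact hA.mem_of_permEq (hA.oplus_mem hu (hA.base_mem a)) hx

theorem padsTo_oplus_base (hA : IsStableFamily A b) (h : PadsTo b u x) (c : ℕ) :
    PadsTo b u (oplus x (b c)) := by
  obtain ⟨a, ha, hx⟩ := h
  refine ⟨a + c, by lia, ?_⟩
  rw [← hA.oplus_base]
  exact (permEq_oplus_assoc u (b a) (b c)).symm.trans (hx.oplus (.refl _))

end IsStableFamily

end Stabilisation

section StableHomotopy

variable {V : Type*} [AddCommGroup V] [Module ℂ V] [StarAddMonoid V]

namespace AbsMatrixOrderUnitSpace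

variable (S : AbsMatrixOrderUnitSpace V) (A : ∀ n, Set (Matrix (Fin n) (Fin n) V))
  (b : ∀ n, Matrix (Fin n) (Fin n) V)

/-- `u ⊕ b a` and `v ⊕ b c` are homotopic in `A k` for some `k > max {m, n}`, where `m + a = k` and
`n + c = k`; this is `∼₁` for `A = U`, `b n = eⁿ` and `∼_K` for `A = PU`, `b n = 0`. -/
def StableHomotopic {m n : ℕ} (u : Matrix (Fin m) (Fin m) V) (v : Matrix (Fin n) (Fin n) V) :
    Prop :=
  ∃ (k a c : ℕ) (ha : m + a = k) (hc : n + c = k), max m n < k ∧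
    S.Homotopic (A k) (castSq ha (oplus u (b a))) (castSq hc (oplus v (b c)))

/-- Some paddings of `u` and `v` to the size `k` are homotopic in `A k`; all of them then are. -/
def HomotopicAtSize (k : ℕ) {m n : ℕ} (u : Matrix (Fin m) (Fin m) V)
    (v : Matrix (Fin n) (Fin n) V) : Prop :=
  ∃ x y : Matrix (Fin k) (Fin k) V, PadsTo b u x ∧ PadsTo b v y ∧ S.Homotopic (A k) x y

variable {S A b} [StarModule ℂ V] {k l m n : ℕ} [NeZero m]
  {u : Matrix (Fin m) (Fin m) V} {v : Matrix (Fin n) (Fin n) V} {w : Matrix (Fin l) (Fin l) V}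

namespace HomotopicAtSize

theorem symm (h : S.HomotopicAtSize A b k u v) : S.HomotopicAtSize A b k v u := by
  obtain ⟨x, y, hux, hvy, h⟩ := h
  have := hux.neZero
  exact ⟨y, x, hvy, hux, Homotopic.symm h⟩

theorem trans [NeZero n] (hA : IsStableFamily A b) (hv : v ∈ A n)
    (h : S.HomotopicAtSize A b k u v) (h' : S.HomotopicAtSize A b k v w) :
    S.HomotopicAtSize A b k u w := by
  obtain ⟨x, y, hux, hvy, h⟩ := h
  obtain ⟨y', z, hvy', hwz, h'⟩ := h'
  have := hux.neZero
  have hy := homotopic_of_permEq (S := S) (hA.isUnitarilyInvariant k) (hA.mem_of_padsTo hv hvy)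
    (hvy.permEq hvy')
  exact ⟨x, z, hux, hwz, Homotopic.trans h (Homotopic.trans hy h')⟩

theorem oplus_right [NeZero l] (hA : IsStableFamily A b) (hw : w ∈ A l)
    (h : S.HomotopicAtSize A b k u v) : S.HomotopicAtSize A b (k + l) (oplus u w) (oplus v w) := by
  obtain ⟨x, y, hux, hvy, h⟩ := h
  have := hux.neZero
  exact ⟨oplus x w, oplus y w, hux.oplus_right w, hvy.oplus_right w,
    Homotopic.map (mContinuous_oplus_right w) (fun _ hx => hA.oplus_mem hx hw) h⟩

theorem add (hA : IsStableFamily A b) (h : S.HomotopicAtSize A b k u v) (c : ℕ) [NeZero c] :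
    S.HomotopicAtSize A b (k + c) u v := by
  obtain ⟨x, y, hux, hvy, h⟩ := h
  have := hux.neZero
  exact ⟨oplus x (b c), oplus y (b c), hA.padsTo_oplus_base hux c, hA.padsTo_oplus_base hvy c,
    Homotopic.map (mContinuous_oplus_right (b c)) (fun _ hx => hA.oplus_mem hx (hA.base_mem c)) h⟩

end HomotopicAtSize

variable [NeZero l] [NeZero n]

theorem stableHomotopic_iff (hA : IsStableFamily A b) (hu : u ∈ A m) (hv : v ∈ A n) :
    S.StableHomotopic A b u v ↔ ∃ k, S.HomotopicAtSize A b k u v := by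
  constructor
  · rintro ⟨k, a, c, ha, hc, lt, h⟩
    exact ⟨k, _, _, ⟨a, by lia, permEq_castSq ha _⟩, ⟨c, by lia, permEq_castSq hc _⟩, h⟩
  · rintro ⟨k, x, y, hux, hvy, h⟩
    have := hux.neZero
    have x_mem := hA.mem_of_padsTo hu hux
    have y_mem := hA.mem_of_padsTo hv hvy
    obtain ⟨a, ha, hx⟩ := hux
    obtain ⟨c, hc, hy⟩ := hvy
    refine ⟨k, a, c, hx.size_eq, hy.size_eq, ?_, ?_⟩
    · have := hx.size_eq
      have := hy.size_eq
      lia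
    · have hA' := hA.isUnitarilyInvariant k
      have hx' := homotopic_of_permEq (S := S) hA' x_mem
        (hx.symm.trans (permEq_castSq hx.size_eq _))
      have hy' := homotopic_of_permEq (S := S) hA' y_mem
        (hy.symm.trans (permEq_castSq hy.size_eq _))
      exact Homotopic.trans (Homotopic.symm hx') (Homotopic.trans h hy')

namespace StableHomotopic

theorem of_padsTo (hA : IsStableFamily A b) (hu : u ∈ A m) (hv : v ∈ A n)
    {x : Matrix (Fin k) (Fin k) V} (hux : PadsTo b u x) (hvx : PadsTo b v x) :
    S.StableHomotopic A b u v := by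
  have := hux.neZero
  exact (stableHomotopic_iff hA hu hv).2 ⟨k, x, x, hux, hvx,
    homotopic_of_permEq (hA.isUnitarilyInvariant k) (hA.mem_of_padsTo hu hux) (.refl x)⟩

theorem of_permEq (hA : IsStableFamily A b) (hu : u ∈ A m) (h : PermEq u v) :
    S.StableHomotopic A b u v :=
  of_padsTo hA hu (hA.mem_of_permEq hu h) (h.padsTo ⟨1, one_pos, .refl _⟩) ⟨1, one_pos, .refl _⟩

theorem oplus_base (hA : IsStableFamily A b) (hu : u ∈ A m) (n : ℕ) [NeZero n] :
    S.StableHomotopic A b (oplus u (b n)) u := by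
  have base_padsTo : PadsTo b u (oplus u (b n)) := ⟨n, NeZero.pos n, .refl _⟩
  exact of_padsTo hA (hA.oplus_mem hu (hA.base_mem n)) hu ⟨1, one_pos, .refl _⟩
    (hA.padsTo_oplus_base base_padsTo 1)

theorem symm (hA : IsStableFamily A b) (hu : u ∈ A m) (hv : v ∈ A n)
    (h : S.StableHomotopic A b u v) : S.StableHomotopic A b v u :=
  (stableHomotopic_iff hA hv hu).2 (((stableHomotopic_iff hA hu hv).1 h).imp fun _ => .symm)

theorem trans (hA : IsStableFamily A b) (hu : u ∈ A m) (hv : v ∈ A n) (hw : w ∈ A l)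
    (h : S.StableHomotopic A b u v) (h' : S.StableHomotopic A b v w) :
    S.StableHomotopic A b u w := by
  obtain ⟨j, h⟩ := (stableHomotopic_iff hA hu hv).1 h
  obtain ⟨k, h'⟩ := (stableHomotopic_iff hA hv hw).1 h'
  have h := h.add hA (k + 1)
  have h' := h'.add hA (j + 1)
  rw [show k + (j + 1) = j + (k + 1) by lia] at h'
  exact (stableHomotopic_iff hA hu hw).2 ⟨_, h.trans hA hv h'⟩

theorem oplus_right (hA : IsStableFamily A b) (hu : u ∈ A m) (hv : v ∈ A n) (hw : w ∈ A l)
    (h : S.StableHomotopic A b u v) : S.StableHomotopic A b (oplus u w) (oplus v w) := by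
  obtain ⟨k, h⟩ := (stableHomotopic_iff hA hu hv).1 h
  exact (stableHomotopic_iff hA (hA.oplus_mem hu hw) (hA.oplus_mem hv hw)).2
    ⟨k + l, h.oplus_right hA hw⟩

end StableHomotopic

variable (S)

theorem isStableFamily_U : IsStableFamily S.U (unitMat S.e) where
  base_mem n _ := S.unit_mem_U (NeZero.pos n)
  oplus_base := oplus_unitMat S.e
  oplus_mem := S.oplus_mem_U (NeZero.pos _) (NeZero.pos _)
  isUnitarilyInvariant _ _ _ hα hα' _ := compress_mem_U hα hα'

theorem isStableFamily_PU : IsStableFamily S.PU fun _ => 0 where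
  base_mem n _ := S.zero_mem_PU (NeZero.pos n)
  oplus_base _ _ := oplus_zero_zero
  oplus_mem := S.oplus_mem_PU (NeZero.pos _) (NeZero.pos _)
  isUnitarilyInvariant _ _ _ hα hα' _ := compress_mem_PU hα hα'

end AbsMatrixOrderUnitSpace

end StableHomotopy

namespace AbsMatrixOrderUnitSpace

variable {V : Type*} [AddCommGroup V] [Module ℂ V] [StarAddMonoid V]
  {S : AbsMatrixOrderUnitSpace V} {k l m n r : ℕ}

section PartialIsometry

theorem PIEquiv.symm {p : Matrix (Fin m) (Fin m) V} {q : Matrix (Fin n) (Fin n) V}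
    (h : S.PIEquiv p q) : S.PIEquiv q p := by
  obtain ⟨v, hv, hp, hq⟩ := h
  exact ⟨vᴴ, ⟨hv.2, by rw [conjTranspose_conjTranspose]; exact hv.1⟩,
    by rwa [conjTranspose_conjTranspose], hp⟩

variable [NeZero l] [NeZero m] [NeZero n] [NeZero r]

theorem PIEquiv.trans (hT : S.CondT) {p : Matrix (Fin l) (Fin l) V} {q : Matrix (Fin m) (Fin m) V}
    {r : Matrix (Fin n) (Fin n) V} (h : S.PIEquiv p q) (h' : S.PIEquiv q r) : S.PIEquiv p r := by
  obtain ⟨u, hu, rfl, rfl⟩ := h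
  obtain ⟨v, hv, rfl, hvu⟩ := h'.symm
  obtain ⟨w, hw, abs_star, abs⟩ :=
    hT l m n (NeZero.pos l) (NeZero.pos m) (NeZero.pos n) u hu v hv hvu
  exact ⟨w, hw, abs_star.symm, abs.symm⟩

theorem PIEquiv.oplus {p : Matrix (Fin m) (Fin m) V} {q : Matrix (Fin n) (Fin n) V}
    {p' : Matrix (Fin l) (Fin l) V} {q' : Matrix (Fin r) (Fin r) V} (h : S.PIEquiv p q)
    (h' : S.PIEquiv p' q') : S.PIEquiv (oplus p p') (oplus q q') := by
  obtain ⟨u, hu, rfl, rfl⟩ := h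
  obtain ⟨v, hv, rfl, rfl⟩ := h'
  have abs := S.abs_oplus_eq u v
  have abs_star := S.abs_oplus_eq uᴴ vᴴ
  rw [← conjTranspose_oplus] at abs_star
  refine ⟨AMOU.oplus u v, ⟨?_, ?_⟩, abs_star.symm, abs.symm⟩
  · rw [abs]
    exact S.oplus_mem_OP (NeZero.pos n) (NeZero.pos r) hu.1 hv.1
  · rw [abs_star]
    exact S.oplus_mem_OP (NeZero.pos m) (NeZero.pos l) hu.2 hv.2

variable [StarModule ℂ V]

-- The partial isometry is `pβ`.
theorem pIEquiv_compress {β : Matrix (Fin m) (Fin n) ℂ} (hβ : β * βᴴ = 1)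
    {p : Matrix (Fin m) (Fin m) V} (hp : p ∈ S.OP m) (hpβ : compress p β ∈ S.OP n) :
    S.PIEquiv p (compress p β) := by
  have p_pos := mem_pos_of_mem_OP hp
  have abs := S.abs_rmul_of_mem_pos hβ p_pos
  have abs_star : S.abs n m (rmul p β)ᴴ = p := by
    rw [conjTranspose_rmul, hp.1, S.abs_lmul_of_isometry (by rwa [conjTranspose_conjTranspose]),
      S.abs_of_mem_pos p_pos]
  exact ⟨rmul p β, ⟨by rwa [abs], by rwa [abs_star]⟩, abs_star.symm, abs.symm⟩

theorem pIEquiv_of_permEq {p : Matrix (Fin m) (Fin m) V} {q : Matrix (Fin n) (Fin n) V}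
    (hp : p ∈ S.OP m) (h : PermEq p q) : S.PIEquiv p q := by
  obtain ⟨σ, rfl⟩ := h
  have coisometry := one_submatrix_mul_conjTranspose σ
  rw [submatrix_eq_compress]
  exact pIEquiv_compress coisometry hp
    (compress_mem_OP coisometry (conjTranspose_mul_self_one_submatrix σ.injective) hp)

theorem pIEquiv_oplus_zero {p : Matrix (Fin m) (Fin m) V} (hp : p ∈ S.OP m) :
    S.PIEquiv p (oplus p (0 : Matrix (Fin n) (Fin n) V)) := by
  have oplus_mem := S.oplus_mem_OP (NeZero.pos m) (NeZero.pos n) hp (S.zero_mem_OP (NeZero.pos n))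
  rw [oplus_zero_eq_compress] at oplus_mem ⊢
  refine pIEquiv_compress ?_ hp oplus_mem
  simpa using conjTranspose_mul_self_one_submatrix (Fin.castAdd_injective m n)

theorem pIEquiv_of_padsTo (hT : S.CondT) {p : Matrix (Fin m) (Fin m) V}
    {x : Matrix (Fin k) (Fin k) V} (hp : p ∈ S.OP m) (h : PadsTo (fun _ => 0) p x) :
    S.PIEquiv p x := by
  have := h.neZero
  obtain ⟨a, ha, hx⟩ := h
  have : NeZero a := .of_pos ha
  have oplus_mem := S.oplus_mem_OP (NeZero.pos m) ha hp (S.zero_mem_OP ha)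
  exact (pIEquiv_oplus_zero hp).trans hT (pIEquiv_of_permEq oplus_mem hx)

end PartialIsometry

section Padding

variable [NeZero m] {u : Matrix (Fin m) (Fin m) V} {x : Matrix (Fin k) (Fin k) V}

theorem padsTo_abs (h : PadsTo (fun _ => 0) u x) :
    PadsTo (fun _ => 0) (S.abs m m u) (S.abs k k x) := by
  have := h.neZero
  obtain ⟨a, ha, σ, rfl⟩ := h
  have : NeZero a := .of_pos ha
  refine ⟨a, ha, σ, ?_⟩
  rw [S.abs_submatrix, S.abs_oplus_eq, S.abs_of_mem_pos (S.zero_mem a ha)]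

theorem padsTo_add_unit_sub_abs (h : PadsTo (fun _ => 0) u x) :
    PadsTo (unitMat S.e) (u + unitMat S.e m - S.abs m m u)
      (x + unitMat S.e k - S.abs k k x) := by
  have := h.neZero
  obtain ⟨a, ha, σ, rfl⟩ := h
  have : NeZero a := .of_pos ha
  have unit_submatrix : unitMat S.e k = (unitMat S.e (m + a)).submatrix σ σ := by
    rw [submatrix_eq_compress, compress_unitMat_of_isometry S.e
      (conjTranspose_mul_self_one_submatrix σ.injective)]
  refine ⟨a, ha, σ, ?_⟩
  calc (oplus u 0).submatrix σ σ + unitMat S.e k - S.abs k k ((oplus u 0).submatrix σ σ)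
      = (oplus u 0 + unitMat S.e (m + a) - S.abs _ _ (oplus u 0)).submatrix σ σ := by
        rw [unit_submatrix, S.abs_submatrix]
        rfl
    _ = _ := by
        rw [S.add_unit_sub_abs_oplus, S.add_unit_sub_abs_of_mem_pos (S.zero_mem a ha)]

end Padding

end AbsMatrixOrderUnitSpace

section Completion

open Algebra

variable {X Y Z : Type*} {add : X → X → X} {zero : X} {Sim : X → X → Prop}

/-- The axioms of a commutative monoid, holding up to the equivalence relation `Sim`. -/
structure IsAddCommMonoidUpTo (add : X → X → X) (zero : X) (Sim : X → X → Prop) : Prop where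
  equivalence : Equivalence Sim
  add_congr_left {x x' : X} (y : X) : Sim x x' → Sim (add x y) (add x' y)
  add_comm (x y : X) : Sim (add x y) (add y x)
  add_assoc (x y z : X) : Sim (add (add x y) z) (add x (add y z))
  add_zero (x : X) : Sim (add x zero) x

/-- The relation `≡_X` identifying the formal differences `x.1 - x.2` and `y.1 - y.2` in the group
completion. -/
def CompletionRel (add : X → X → X) (Sim : X → X → Prop) (x y : X × X) : Prop :=
  ∃ z, Sim (add (add x.1 y.2) z) (add (add y.1 x.2) z)

/-- The group completion as a set of classes of pairs: `K₀(V)`, `K₁(V)` and `K(V)` are of this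
form. -/
abbrev Completion (add : X → X → X) (Sim : X → X → Prop) : Type _ := Quot (CompletionRel add Sim)

theorem surjective_prod {G H K : Type*} [AddGroup G] [AddGroup H] [AddGroup K] {f : G →+ H}
    {g : G →+ K} (hf : ∀ a, ∃ x, f x = a ∧ g x = 0) (hg : Function.Surjective g) :
    Function.Surjective (f.prod g) := by
  rintro ⟨a, b⟩
  obtain ⟨y, rfl⟩ := hg b
  obtain ⟨x, hfx, hgx⟩ := hf (a - f y)
  exact ⟨x + y, by simp [hfx, hgx]⟩

namespace IsAddCommMonoidUpTo

theorem add_congr (h : IsAddCommMonoidUpTo add zero Sim) {x x' y y' : X} (hx : Sim x x')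
    (hy : Sim y y') : Sim (add x y) (add x' y') :=
  h.equivalence.trans (h.add_congr_left y hx) <| h.equivalence.trans (h.add_comm x' y) <|
    h.equivalence.trans (h.add_congr_left x' hy) (h.add_comm y' x')

/-- The commutative monoid `X / Sim`. -/
def Classes (h : IsAddCommMonoidUpTo add zero Sim) : Type _ := Quotient ⟨Sim, h.equivalence⟩

/-- The class of `x` in `X / Sim`. -/
def cls (h : IsAddCommMonoidUpTo add zero Sim) (x : X) : h.Classes := Quotient.mk _ x

theorem cls_eq_cls_iff (h : IsAddCommMonoidUpTo add zero Sim) {x y : X} :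
    h.cls x = h.cls y ↔ Sim x y :=
  Quotient.eq

instance (h : IsAddCommMonoidUpTo add zero Sim) : Add h.Classes :=
  ⟨Quotient.map₂ add fun _ _ hx _ _ hy => h.add_congr hx hy⟩

instance (h : IsAddCommMonoidUpTo add zero Sim) : Zero h.Classes := ⟨h.cls zero⟩

instance (h : IsAddCommMonoidUpTo add zero Sim) : AddCommMonoid h.Classes where
  add_assoc := by
    rintro ⟨x⟩ ⟨y⟩ ⟨z⟩
    exact Quotient.sound (h.add_assoc x y z)
  add_comm := by
    rintro ⟨x⟩ ⟨y⟩
    exact Quotient.sound (h.add_comm x y)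
  add_zero := by
    rintro ⟨x⟩
    exact Quotient.sound (h.add_zero x)
  zero_add := by
    rintro ⟨x⟩
    exact Quotient.sound (h.equivalence.trans (h.add_comm zero x) (h.add_zero x))
  nsmul := nsmulRec

theorem cls_add (h : IsAddCommMonoidUpTo add zero Sim) (x y : X) :
    h.cls (add x y) = h.cls x + h.cls y := rfl

/-- The formal difference of the classes of `x.1` and `x.2`. -/
noncomputable def diff (h : IsAddCommMonoidUpTo add zero Sim) (x : X × X) :
    GrothendieckAddGroup h.Classes :=
  GrothendieckAddGroup.of (h.cls x.1) - GrothendieckAddGroup.of (h.cls x.2)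

theorem diff_eq_diff_iff (h : IsAddCommMonoidUpTo add zero Sim) {x y : X × X} :
    h.diff x = h.diff y ↔ CompletionRel add Sim x y := by
  rw [diff, diff, sub_eq_sub_iff_add_eq_add, ← map_add, ← map_add, ← h.cls_add, ← h.cls_add]
  refine (AddSubmonoid.LocalizationMap.eq_iff_exists _).trans ?_
  constructor
  · rintro ⟨⟨⟨z⟩, _⟩, hz⟩
    refine ⟨z, h.cls_eq_cls_iff.1 ?_⟩
    rw [h.cls_add _ z, h.cls_add _ z, _root_.add_comm, _root_.add_comm _ (h.cls z)]
    exact hz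
  · rintro ⟨z, hz⟩
    refine ⟨⟨h.cls z, AddSubmonoid.mem_top _⟩, ?_⟩
    have cls_eq := h.cls_eq_cls_iff.2 hz
    rwa [h.cls_add _ z, h.cls_add _ z, _root_.add_comm, _root_.add_comm _ (h.cls z)] at cls_eq

theorem diff_surjective (h : IsAddCommMonoidUpTo add zero Sim) : Function.Surjective h.diff := by
  intro a
  obtain ⟨⟨⟨x⟩, ⟨y⟩, _⟩, hxy⟩ := (AddLocalization.addMonoidOf ⊤).surj a
  exact ⟨(x, y), (eq_sub_of_add_eq hxy).symm⟩

theorem diff_add_diff (h : IsAddCommMonoidUpTo add zero Sim) (x₁ y₁ x₂ y₂ : X) :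
    h.diff (x₁, y₁) + h.diff (x₂, y₂) = h.diff (add x₁ x₂, add y₁ y₂) := by
  simp only [diff, h.cls_add, map_add]
  exact sub_add_sub_comm ..

theorem diff_eq_zero (h : IsAddCommMonoidUpTo add zero Sim) {x y : X} (hxy : Sim x y) :
    h.diff (x, y) = 0 := by
  rw [diff, h.cls_eq_cls_iff.2 hxy, sub_self]

theorem equivalence_completionRel (h : IsAddCommMonoidUpTo add zero Sim) :
    Equivalence (CompletionRel add Sim) := by
  have : CompletionRel add Sim = fun x y => h.diff x = h.diff y := by
    ext x y
    exact h.diff_eq_diff_iff.symm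
  exact this ▸ eq_equivalence.comap h.diff

/-- The classes of pairs form Mathlib's Grothendieck group of `X / Sim`. -/
noncomputable def completionEquiv (h : IsAddCommMonoidUpTo add zero Sim) :
    Completion add Sim ≃ GrothendieckAddGroup h.Classes :=
  Equiv.ofBijective (Quot.lift h.diff fun _ _ => h.diff_eq_diff_iff.2) <| by
    refine ⟨?_, Quot.surjective_lift _ |>.2 h.diff_surjective⟩
    rintro ⟨x⟩ ⟨y⟩ hxy
    exact Quot.sound (h.diff_eq_diff_iff.1 hxy)

/-- The group structure with `[(x₁, y₁)] + [(x₂, y₂)] = [(x₁ + x₂, y₁ + y₂)]`. -/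
@[reducible] noncomputable def addCommGroup (h : IsAddCommMonoidUpTo add zero Sim) :
    AddCommGroup (Completion add Sim) :=
  h.completionEquiv.addCommGroup

theorem mk_add_mk (h : IsAddCommMonoidUpTo add zero Sim) (x₁ y₁ x₂ y₂ : X) :
    letI := h.addCommGroup
    (Quot.mk _ (x₁, y₁) + Quot.mk _ (x₂, y₂) : Completion add Sim) =
      Quot.mk _ (add x₁ x₂, add y₁ y₂) :=
  h.completionEquiv.injective <|
    (h.completionEquiv.apply_symm_apply _).trans (h.diff_add_diff x₁ y₁ x₂ y₂)

theorem mk_eq_zero (h : IsAddCommMonoidUpTo add zero Sim) {x y : X} (hxy : Sim x y) :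
    letI := h.addCommGroup
    (Quot.mk _ (x, y) : Completion add Sim) = 0 :=
  h.completionEquiv.injective <|
    (h.diff_eq_zero hxy).trans (h.completionEquiv.apply_symm_apply 0).symm

variable {add' : Y → Y → Y} {zero' : Y} {Sim' : Y → Y → Prop}

/-- The homomorphism `[(x, y)] ↦ [(f x, f y)]` of group completions induced by `f`. -/
noncomputable def completionHom (h : IsAddCommMonoidUpTo add zero Sim)
    (h' : IsAddCommMonoidUpTo add' zero' Sim') (f : X → Y)
    (hf : ∀ x y, f (add x y) = add' (f x) (f y)) (hsim : ∀ x y, Sim x y → Sim' (f x) (f y)) :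
    letI := h.addCommGroup
    letI := h'.addCommGroup
    Completion add Sim →+ Completion add' Sim' :=
  letI := h.addCommGroup
  letI := h'.addCommGroup
  AddMonoidHom.mk' (Quot.map (Prod.map f f) fun x y ⟨z, hz⟩ => ⟨f z, by
    simpa only [hf, Prod.map_fst, Prod.map_snd] using hsim _ _ hz⟩) <| by
    rintro ⟨x⟩ ⟨y⟩
    rw [h.mk_add_mk]
    simp only [Quot.map, Prod.map, hf]
    exact (h'.mk_add_mk ..).symm

variable {add'' : Z → Z → Z} {zero'' : Z} {Sim'' : Z → Z → Prop}

theorem surjective_completionHom_prod (h : IsAddCommMonoidUpTo add zero Sim)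
    (h' : IsAddCommMonoidUpTo add' zero' Sim') (h'' : IsAddCommMonoidUpTo add'' zero'' Sim'')
    {f : X → Y} {hf : ∀ x y, f (add x y) = add' (f x) (f y)}
    {hfsim : ∀ x y, Sim x y → Sim' (f x) (f y)}
    {g : X → Z} {hg : ∀ x y, g (add x y) = add'' (g x) (g y)}
    {hgsim : ∀ x y, Sim x y → Sim'' (g x) (g y)} {s : Y → X} {t : Z → X}
    (hfs : Function.LeftInverse f s) (hgs : ∀ y y', Sim'' (g (s y)) (g (s y')))
    (hgt : Function.LeftInverse g t) :
    letI := h.addCommGroup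
    letI := h'.addCommGroup
    letI := h''.addCommGroup
    Function.Surjective
      ((h.completionHom h' f hf hfsim).prod (h.completionHom h'' g hg hgsim)) := by
  let := h.addCommGroup
  let := h'.addCommGroup
  let := h''.addCommGroup
  refine surjective_prod ?_ ?_
  · rintro ⟨y, y'⟩
    refine ⟨Quot.mk _ (s y, s y'), ?_, h''.mk_eq_zero (hgs y y')⟩
    exact congrArg₂ (fun y y' => Quot.mk _ (y, y')) (hfs y) (hfs y')
  · rintro ⟨z, z'⟩
    exact ⟨Quot.mk _ (t z, t z'), congrArg₂ (fun z z' => Quot.mk _ (z, z')) (hgt z) (hgt z')⟩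

end IsAddCommMonoidUpTo

end Completion

section Theta

open AbsMatrixOrderUnitSpace

variable {V : Type*} [AddCommGroup V] [Module ℂ V] [StarAddMonoid V]
  {S : AbsMatrixOrderUnitSpace V}

namespace AbsMatrixOrderUnitSpace

instance (p : S.OPInf) : NeZero p.n := .of_pos p.hn

instance (u : S.UInf) : NeZero u.n := .of_pos u.hn

instance (u : S.PUInf) : NeZero u.n := .of_pos u.hn

theorem OPInf.mk_congr {n : ℕ} {hn : 0 < n} {p q : Matrix (Fin n) (Fin n) V} {hp : p ∈ S.OP n}
    {hq : q ∈ S.OP n} (h : p = q) : (⟨n, hn, p, hp⟩ : S.OPInf) = ⟨n, hn, q, hq⟩ := by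
  subst h
  rfl

theorem UInf.mk_congr {n : ℕ} {hn : 0 < n} {u v : Matrix (Fin n) (Fin n) V} {hu : u ∈ S.U n}
    {hv : v ∈ S.U n} (h : u = v) : (⟨n, hn, u, hu⟩ : S.UInf) = ⟨n, hn, v, hv⟩ := by
  subst h
  rfl

/-- An order projection regarded as a partial unitary. -/
def OPInf.toPUInf (p : S.OPInf) : S.PUInf := ⟨p.n, p.hn, p.val, mem_PU_of_mem_OP p.mem⟩

/-- A unitary regarded as a partial unitary. -/
def UInf.toPUInf (u : S.UInf) : S.PUInf := ⟨u.n, u.hn, u.val, mem_PU_of_mem_U u.mem⟩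

theorem PUInf.absProj_sum (u v : S.PUInf) : (u.sum v).absProj = u.absProj.sum v.absProj :=
  OPInf.mk_congr (S.abs_oplus_eq u.val v.val)

theorem PUInf.absProj_zero : (zero S).absProj = OPInf.zero S :=
  OPInf.mk_congr (S.abs_of_mem_pos (S.zero_mem 1 one_pos))

theorem OPInf.absProj_toPUInf (p : S.OPInf) : p.toPUInf.absProj = p :=
  OPInf.mk_congr (S.abs_of_mem_pos (mem_pos_of_mem_OP p.mem))

/-- The unitary `u + eⁿ - |u|` extending a partial unitary `u ∈ PU_n(V)`. -/
def PUInf.toUnitary (u : S.PUInf) : S.UInf :=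
  ⟨u.n, u.hn, u.val + unitMat S.e u.n - S.abs u.n u.n u.val, add_unit_sub_abs_mem_U u.mem⟩

theorem PUInf.toUnitary_sum (u v : S.PUInf) :
    (u.sum v).toUnitary = u.toUnitary.sum v.toUnitary :=
  UInf.mk_congr (S.add_unit_sub_abs_oplus u.val v.val)

theorem PUInf.toUnitary_zero : (zero S).toUnitary = UInf.unit S :=
  UInf.mk_congr (S.add_unit_sub_abs_of_mem_pos (S.zero_mem 1 one_pos))

theorem UInf.toUnitary_toPUInf (u : S.UInf) : u.toPUInf.toUnitary = u :=
  UInf.mk_congr (S.add_unit_sub_abs_of_mem_U u.mem)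

variable [StarModule ℂ V]

theorem OPInf.sim_toUnitary_toPUInf (p q : S.OPInf) :
    p.toPUInf.toUnitary.Sim q.toPUInf.toUnitary := by
  have toUnitary_eq_unit (p : S.OPInf) : p.toPUInf.toUnitary.val = unitMat S.e p.n :=
    S.add_unit_sub_abs_of_mem_pos (mem_pos_of_mem_OP p.mem)
  have p_padsTo : PadsTo (unitMat S.e) p.toPUInf.toUnitary.val (unitMat S.e (p.n + q.n)) :=
    ⟨q.n, q.hn, by rw [toUnitary_eq_unit, ← oplus_unitMat]; exact .refl _⟩
  have q_padsTo : PadsTo (unitMat S.e) q.toPUInf.toUnitary.val (unitMat S.e (p.n + q.n)) :=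
    ⟨p.n, p.hn, by rw [toUnitary_eq_unit, ← oplus_unitMat]; exact permEq_oplus_comm _ _⟩
  exact StableHomotopic.of_padsTo (isStableFamily_U S) p.toPUInf.toUnitary.mem
    q.toPUInf.toUnitary.mem p_padsTo q_padsTo

theorem PUInf.Sim.absProj (hT : S.CondT) (hcont : ∀ n : ℕ, 0 < n → S.AbsContinuous n)
    (hhom : ∀ n : ℕ, 0 < n → ∀ p ∈ S.OP n, ∀ q ∈ S.OP n,
      S.Homotopic (S.OP n) p q → S.PIEquiv p q) {u v : S.PUInf} (h : u.Sim v) :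
    u.absProj.Sim v.absProj := by
  have hPU := isStableFamily_PU S
  obtain ⟨k, x, y, hux, hvy, h⟩ := (stableHomotopic_iff hPU u.mem v.mem).1 h
  have := hux.neZero
  have abs_homotopic : S.Homotopic (S.OP k) (S.abs k k x) (S.abs k k y) :=
    Homotopic.map (hcont k (NeZero.pos k)) (fun _ hz => hz.2) h
  have abs_equiv : S.PIEquiv (S.abs k k x) (S.abs k k y) :=
    hhom k (NeZero.pos k) _ (hPU.mem_of_padsTo u.mem hux).2 _ (hPU.mem_of_padsTo v.mem hvy).2
      abs_homotopic
  have u_equiv := pIEquiv_of_padsTo hT u.absProj.mem (padsTo_abs hux)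
  have v_equiv := pIEquiv_of_padsTo hT v.absProj.mem (padsTo_abs hvy)
  exact u_equiv.trans hT (abs_equiv.trans hT v_equiv.symm)

theorem PUInf.Sim.toUnitary (hcont : ∀ n : ℕ, 0 < n → S.AbsContinuous n) {u v : S.PUInf}
    (h : u.Sim v) : u.toUnitary.Sim v.toUnitary := by
  obtain ⟨k, x, y, hux, hvy, h⟩ := (stableHomotopic_iff (isStableFamily_PU S) u.mem v.mem).1 h
  have := hux.neZero
  refine (stableHomotopic_iff (isStableFamily_U S) u.toUnitary.mem v.toUnitary.mem).2
    ⟨k, _, _, padsTo_add_unit_sub_abs hux, padsTo_add_unit_sub_abs hvy, ?_⟩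
  exact Homotopic.map (mContinuous_add_unit_sub_abs (hcont k (NeZero.pos k)))
    (fun _ hz => add_unit_sub_abs_mem_U hz) h

theorem isAddCommMonoidUpTo_OPInf (hT : S.CondT) :
    IsAddCommMonoidUpTo OPInf.sum (OPInf.zero S) OPInf.Sim where
  equivalence := ⟨fun p => pIEquiv_of_permEq p.mem (.refl _), .symm, .trans hT⟩
  add_congr_left q h := h.oplus (pIEquiv_of_permEq q.mem (.refl _))
  add_comm p q := pIEquiv_of_permEq (p.sum q).mem (permEq_oplus_comm p.val q.val)
  add_assoc p q r :=
    pIEquiv_of_permEq ((p.sum q).sum r).mem (permEq_oplus_assoc p.val q.val r.val)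
  add_zero p := (pIEquiv_oplus_zero p.mem).symm

theorem isAddCommMonoidUpTo_UInf (S : AbsMatrixOrderUnitSpace V) :
    IsAddCommMonoidUpTo UInf.sum (UInf.unit S) UInf.Sim :=
  have hU := isStableFamily_U S
  { equivalence :=
      ⟨fun u => StableHomotopic.of_permEq hU u.mem (.refl _),
        fun {u v} => StableHomotopic.symm hU u.mem v.mem,
        fun {u v w} => StableHomotopic.trans hU u.mem v.mem w.mem⟩
    add_congr_left {u v} w := StableHomotopic.oplus_right hU u.mem v.mem w.mem
    add_comm u v := StableHomotopic.of_permEq hU (u.sum v).mem (permEq_oplus_comm u.val v.val)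
    add_assoc u v w :=
      StableHomotopic.of_permEq hU ((u.sum v).sum w).mem (permEq_oplus_assoc u.val v.val w.val)
    add_zero u := StableHomotopic.oplus_base hU u.mem 1 }

theorem isAddCommMonoidUpTo_PUInf (S : AbsMatrixOrderUnitSpace V) :
    IsAddCommMonoidUpTo PUInf.sum (PUInf.zero S) PUInf.Sim :=
  have hPU := isStableFamily_PU S
  { equivalence :=
      ⟨fun u => StableHomotopic.of_permEq hPU u.mem (.refl _),
        fun {u v} => StableHomotopic.symm hPU u.mem v.mem,
        fun {u v w} => StableHomotopic.trans hPU u.mem v.mem w.mem⟩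
    add_congr_left {u v} w := StableHomotopic.oplus_right hPU u.mem v.mem w.mem
    add_comm u v := StableHomotopic.of_permEq hPU (u.sum v).mem (permEq_oplus_comm u.val v.val)
    add_assoc u v w :=
      StableHomotopic.of_permEq hPU ((u.sum v).sum w).mem (permEq_oplus_assoc u.val v.val w.val)
    add_zero u := StableHomotopic.oplus_base hPU u.mem 1 }

end AbsMatrixOrderUnitSpace

end Theta

end AMOU

open AMOU AbsMatrixOrderUnitSpace in
theorem theorem5p8 {V : Type*} [AddCommGroup V] [Module ℂ V] [StarAddMonoid V] [StarModule ℂ V]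
    (S : AbsMatrixOrderUnitSpace V)
    (hT : S.CondT)
    (hcont : ∀ n : ℕ, 0 < n → S.AbsContinuous n)
    (hhom : ∀ n : ℕ, 0 < n → ∀ p ∈ S.OP n, ∀ q ∈ S.OP n,
      S.Homotopic (S.OP n) p q → S.PIEquiv p q) :
    Equivalence S.K0Rel ∧ Equivalence S.K1Rel ∧ Equivalence S.KRel ∧
    ∃ (_ : AddCommGroup S.K0) (_ : AddCommGroup S.K1) (_ : AddCommGroup S.K),
      (∀ p₁ q₁ p₂ q₂ : S.OPInf, K0.mk p₁ q₁ + K0.mk p₂ q₂ = K0.mk (p₁.sum p₂) (q₁.sum q₂)) ∧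
      (∀ u₁ v₁ u₂ v₂ : S.UInf, K1.mk u₁ v₁ + K1.mk u₂ v₂ = K1.mk (u₁.sum u₂) (v₁.sum v₂)) ∧
      (∀ u₁ v₁ u₂ v₂ : S.PUInf, K.mk u₁ v₁ + K.mk u₂ v₂ = K.mk (u₁.sum u₂) (v₁.sum v₂)) ∧
      ∃ θ : S.K →+ S.K0 × S.K1,
        Function.Surjective θ ∧
        (∀ u : S.PUInf, ∃ h : u.val + unitMat S.e u.n - S.abs u.n u.n u.val ∈ S.U u.n,
          θ (K.mk u (PUInf.zero S)) =
            (K0.mk u.absProj (OPInf.zero S), K1.mk ⟨u.n, u.hn, _, h⟩ (UInf.unit S))) ∧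
        Nonempty (S.K ⧸ θ.ker ≃+ S.K0 × S.K1) := by
  have h₀ := isAddCommMonoidUpTo_OPInf hT
  have h₁ := isAddCommMonoidUpTo_UInf S
  have h := isAddCommMonoidUpTo_PUInf S
  let : AddCommGroup S.K0 := h₀.addCommGroup
  let : AddCommGroup S.K1 := h₁.addCommGroup
  let : AddCommGroup S.K := h.addCommGroup
  let toK0 : S.K →+ S.K0 :=
    h.completionHom h₀ PUInf.absProj PUInf.absProj_sum fun _ _ => PUInf.Sim.absProj hT hcont hhom
  let toK1 : S.K →+ S.K1 :=
    h.completionHom h₁ PUInf.toUnitary PUInf.toUnitary_sum fun _ _ => PUInf.Sim.toUnitary hcont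
  have surjective : Function.Surjective (toK0.prod toK1) :=
    h.surjective_completionHom_prod h₀ h₁ OPInf.absProj_toPUInf
      OPInf.sim_toUnitary_toPUInf UInf.toUnitary_toPUInf
  exact ⟨h₀.equivalence_completionRel, h₁.equivalence_completionRel, h.equivalence_completionRel,
    h₀.addCommGroup, h₁.addCommGroup, h.addCommGroup, h₀.mk_add_mk, h₁.mk_add_mk, h.mk_add_mk,
    toK0.prod toK1, surjective,
    fun u => ⟨add_unit_sub_abs_mem_U u.mem, congrArg₂ (fun p v => (K0.mk _ p, K1.mk _ v))
      PUInf.absProj_zero PUInf.toUnitary_zero⟩,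
    ⟨QuotientAddGroup.quotientKerEquivOfSurjective _ surjective⟩⟩
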